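/- Let $k$ be an algebraically closed field of characteristic zero. A (closed) subscheme $X\subset\mathbb P^n_k$ is given by its saturated homogeneous ideal $I_X\subset A=k[X_0,\dots,X_n]$; its Hilbert function is $\phi_X(l)=\dim_k (A/I_X)_l$. The empty subscheme ($I_X=A$) is allowed, has every dimension and degree $0$. Otherwise $\dim X$ is the Krull dimension of $A/I_X$ minus one, and with $m=\dim X$ the degree of $X$ is the coefficient of $l^m/m!$ in its Hilbert polynomial. $X$ is ACM if $A/I_X$ has a regular sequence of $\dim X+1$ homogeneous elements of positive degree, and degenerate if it lies in a hyperplane. A complete intersection of type $(a,b)$ is a subscheme whose ideal is generated by a regular sequence of two forms of degrees $a,b$ (it is empty if $a=0$ or $b=0$). If $X\subset Z$, the residual of $X$ in $Z$ is the subscheme $X'$ with $I_{X'}=(I_Z:I_X)$. Proposition. Let $s,d,r,\alpha$ be non-negative integers with $\alpha=sd-r$ and $r<d$. Let $\Delta\subset\mathbb P^n$ be the residual of a complete intersection of type $(1,r)$ in a complete intersection of type $(s,d)$. Let $Y\subset\mathbb P^n$ be an ACM subscheme of codimension two and degree $\alpha$ contained in an irreducible (and reduced) hypersurface of degree $d$,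 i.e. some irreducible form of degree $d$ belongs to $I_Y$. Then $\phi_Y(l)\ge\phi_\Delta(l)$ for all $l\ge 0$. Moreover, $\phi_Y(l)=\phi_\Delta(l)$ for all $l\ge0$ if and only if $Y$ is, like $\Delta$, the residual, in some complete intersection of type $(s,d)$, of a degenerate subscheme of codimension two and degree $r$. -/

import Mathlib

/-- The homogeneous coordinate ring `k[X_0, …, X_n]` of `ℙⁿ`. -/
abbrev HomogCoordRing (k : Type*) [Field k] (n : ℕ) : Type _ := MvPolynomial (Fin (n + 1)) k

/-- A closed subscheme of `ℙⁿ` over `k`, given by its saturated homogeneous ideal. The unit ideal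
is the empty subscheme. An ideal is homogeneous if it contains the homogeneous components of each of
its elements. -/
structure ProjSubscheme (k : Type*) [Field k] (n : ℕ) where
  ideal : Ideal (HomogCoordRing k n)
  homogeneous : ∀ f ∈ ideal, ∀ e : ℕ, MvPolynomial.homogeneousComponent e f ∈ ideal
  saturated : ∀ f : HomogCoordRing k n,
    (∃ e : ℕ, ∀ g : HomogCoordRing k n, g.IsHomogeneous e → f * g ∈ ideal) → f ∈ ideal

namespace ProjSubscheme

variable {k : Type*} [Field k] {n : ℕ}

/-- The graded coordinate ring `A_X = k[X_0, …, X_n] / I_X`. -/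
abbrev coordRing (X : ProjSubscheme k n) : Type _ := HomogCoordRing k n ⧸ X.ideal

/-- The Hilbert function `φ_X(l) = dim_k A_X(l)`; the degree `l` part of `A_X` is the image of the
forms of degree `l`. -/
noncomputable def hilbertFunction (X : ProjSubscheme k n) (l : ℕ) : ℕ :=
  Module.finrank k
    ((MvPolynomial.homogeneousSubmodule (Fin (n + 1)) k l).map
      (Ideal.Quotient.mkₐ k X.ideal).toLinearMap)

/-- `X` has dimension `m` as a projective subscheme: `A_X` has Krull dimension `m + 1`.
By convention the empty subscheme has every dimension. -/
def HasDim (X : ProjSubscheme k n) (m : ℕ) : Prop :=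
  X.ideal = ⊤ ∨ ringKrullDim X.coordRing = ((m + 1 : ℕ) : WithBot ℕ∞)

/-- `X` has codimension `c` in `ℙⁿ`. -/
def HasCodim (X : ProjSubscheme k n) (c : ℕ) : Prop :=
  ∃ m : ℕ, m + c = n ∧ X.HasDim m

/-- `X` has degree `α`: with `m = dim X`, `α` is the coefficient of `l ^ m / m!` in the Hilbert
polynomial of `X`. -/
def HasDegree (X : ProjSubscheme k n) (α : ℕ) : Prop :=
  ∃ m : ℕ, X.HasDim m ∧ ∃ P : Polynomial ℚ,
    (∃ l₀ : ℕ, ∀ l : ℕ, l₀ ≤ l → (X.hilbertFunction l : ℚ) = P.eval (l : ℚ)) ∧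
    P.coeff m * (m.factorial : ℚ) = (α : ℚ)

/-- `X` is arithmetically Cohen–Macaulay: `A_X` admits a regular sequence of `dim X + 1`
homogeneous elements (of positive degree). -/
def IsACM (X : ProjSubscheme k n) : Prop :=
  ∃ m : ℕ, X.HasDim m ∧ ∃ fs : List (HomogCoordRing k n),
    fs.length = m + 1 ∧
    (∀ f ∈ fs, ∃ e : ℕ, 0 < e ∧ f.IsHomogeneous e) ∧
    RingTheory.Sequence.IsWeaklyRegular X.coordRing fs

/-- `X` is a complete intersection of type `(a, b)`: its ideal is generated by a regular sequence
of two forms of degrees `a` and `b`. If `a` or `b` is `0`, this is the empty subscheme. -/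
def IsCompleteIntersection (X : ProjSubscheme k n) (a b : ℕ) : Prop :=
  ∃ f g : HomogCoordRing k n, f.IsHomogeneous a ∧ g.IsHomogeneous b ∧
    RingTheory.Sequence.IsWeaklyRegular (HomogCoordRing k n) [f, g] ∧
    X.ideal = Ideal.span {f, g}

/-- `X'` is the residual of `X` in `Z`: `X ⊆ Z` and `I_{X'} = (I_Z : I_X)`. -/
def IsResidual (X' X Z : ProjSubscheme k n) : Prop :=
  Z.ideal ≤ X.ideal ∧
    ∀ f : HomogCoordRing k n, f ∈ X'.ideal ↔ ∀ g ∈ X.ideal, f * g ∈ Z.ideal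

/-- `X` is degenerate: it is contained in a hyperplane. -/
def IsDegenerate (X : ProjSubscheme k n) : Prop :=
  ∃ h : HomogCoordRing k n, h ≠ 0 ∧ h.IsHomogeneous 1 ∧ h ∈ X.ideal

end ProjSubscheme

/-! Write n = q + 2 and let I be the ideal of Y, of depth at least q + 1. As k is infinite, q + 1
general linear forms, generating an ideal K, are regular modulo I and reduce the polynomial ring to
two variables. The Hilbert function h of A/(I + K) is the h-vector of Y: its values are the
coefficients of (1 - X)^(q+1) HS(I). It does not depend on K, has finite support and sums to α. The
Hilbert function of Y is recovered from h by q + 1 successive summations, so comparing h-vectors by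
partial sums suffices.

The constraints on h (`isAdmissible_of_depthGE`) are: h ≤ d; h(l) = l + 1 below the initial degree e
of I and h is nonincreasing from degree e - 1 on; and, from degree d - 1 on, h takes the same value
twice in a row only if that value is 0 or d. The last constraint uses the irreducibility of F. If I
has a form G of degree at most l + 1 not divisible by F, then F, G is a regular sequence, so the
forms of degree at most l + 1 cut out something finite in the plane section. An equality h(l) =
h(l+1) ≠ 0 makes multiplication by x injective on their quotient from degree l on, which contradicts
finiteness (`IsPlane.hilb_eq_zero_of_flat`).

The h-vector of Δ is that of a complete intersection (s, d), lowered by 1 in the last r degrees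
before s + d - 1 (`linkedH`). An admissible h that once falls below `linkedH` never rises above it
again. Both have total sd - r, so each partial sum of h is at least that of `linkedH`. This is the
inequality.

If equality holds, I contains a form f of degree s not divisible by F, hence W = (f, F). The socle
of a complete intersection in two variables lies in degree s + d - 2 only (`IsPlane.mem_of_socle`),
so I is generated by W and one form u of degree s + d - 1 - r. The series of (W : u) is that of a
complete intersection (1, r), so (W : u) is one, and determinantal linkage identifies I with its
residual in W.

Conversely, if Y is residual to a degenerate D and t is a linear form in the ideal of D, then tI ⊆
W. This bounds the difference of the h-vectors of W and Y by 1. By the socle property its support is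
an interval ending at s + d - 2, and the degree gives its length r. So h is `linkedH`
(`hVector_eq_linkedH`). -/

open MvPolynomial

/-! ### Graded ideals, Hilbert functions and Hilbert series. -/

namespace GradedIdeal

variable {σ k : Type*} [Field k]

/-- An ideal of a polynomial ring that is homogeneous for the standard grading. -/
def IsGraded (I : Ideal (MvPolynomial σ k)) : Prop :=
  ∀ f ∈ I, ∀ e : ℕ, homogeneousComponent e f ∈ I

/-- `f` is a nonzerodivisor modulo `I`. -/
def Reg {R : Type*} [CommRing R] (I : Ideal R) (f : R) : Prop := ∀ z, f * z ∈ I → z ∈ I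

/-- The ideal quotient `(I : u)`. -/
def quot {R : Type*} [CommRing R] (I : Ideal R) (u : R) : Ideal R where
  carrier := {z | u * z ∈ I}
  add_mem' ha hb := by
    simp only [Set.mem_ofPred_eq, mul_add] at *
    exact I.add_mem ha hb
  zero_mem' := by simp
  smul_mem' c x hx := by
    simp only [Set.mem_ofPred_eq, smul_eq_mul] at *
    rw [mul_left_comm]
    exact I.mul_mem_left _ hx

theorem mem_quot {R : Type*} [CommRing R] {I : Ideal R} {u z : R} : z ∈ quot I u ↔ u * z ∈ I :=
  Iff.rfl

theorem le_quot {R : Type*} [CommRing R] (I : Ideal R) (u : R) : I ≤ quot I u :=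
  fun _ hz => I.mul_mem_left _ hz

theorem Reg.quot_eq {R : Type*} [CommRing R] {I : Ideal R} {u : R} (h : Reg I u) : quot I u = I :=
  le_antisymm (fun z hz => h z hz) (le_quot I u)

theorem mem_sup_span {R : Type*} [CommRing R] {I : Ideal R} {u z : R} :
    z ∈ I ⊔ Ideal.span {u} ↔ ∃ a, z - a * u ∈ I := by
  rw [sup_comm, Ideal.mem_span_singleton_sup]
  constructor
  · rintro ⟨a, b, hb, rfl⟩
    exact ⟨a, by simpa using hb⟩
  · rintro ⟨a, ha⟩
    exact ⟨a, _, ha, by ring⟩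

theorem homogeneousComponent_mul_of_homogeneous {u : MvPolynomial σ k} {c : ℕ}
    (hu : u.IsHomogeneous c) (a : MvPolynomial σ k) (l : ℕ) :
    homogeneousComponent (l + c) (a * u) = homogeneousComponent l a * u := by
  conv_lhs => rw [← sum_homogeneousComponent a, Finset.sum_mul, map_sum]
  have : ∀ i, homogeneousComponent (l + c) (homogeneousComponent i a * u) =
      if i = l then homogeneousComponent i a * u else 0 := by
    intro i
    rw [homogeneousComponent_of_mem (((homogeneousComponent_isHomogeneous i a).mul hu))]
    simp [eq_comm]
  simp only [this, Finset.sum_ite_eq', Finset.mem_range]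
  split_ifs with h
  · rfl
  · rw [homogeneousComponent_eq_zero _ _ (by omega), zero_mul]

theorem homogeneousComponent_mul_of_lt {u : MvPolynomial σ k} {c : ℕ}
    (hu : u.IsHomogeneous c) (a : MvPolynomial σ k) {l : ℕ} (hl : l < c) :
    homogeneousComponent l (a * u) = 0 := by
  conv_lhs => rw [← sum_homogeneousComponent a, Finset.sum_mul, map_sum]
  refine Finset.sum_eq_zero fun i _ => ?_
  rw [homogeneousComponent_of_mem (((homogeneousComponent_isHomogeneous i a).mul hu)),
    if_neg (by omega)]

theorem homogeneousComponent_self {u : MvPolynomial σ k} {c : ℕ} (hu : u.IsHomogeneous c) :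
    homogeneousComponent c u = u := by
  rw [homogeneousComponent_of_mem hu, if_pos rfl]

theorem mem_of_homogeneousComponent_mem {I : Ideal (MvPolynomial σ k)} {f : MvPolynomial σ k}
    (h : ∀ e, homogeneousComponent e f ∈ I) : f ∈ I := by
  rw [← sum_homogeneousComponent f]
  exact Ideal.sum_mem _ fun i _ => h i

/-- Two graded ideals are comparable as soon as their homogeneous elements are. -/
theorem IsGraded.le_of_homogeneous {I J : Ideal (MvPolynomial σ k)} (hI : IsGraded I)
    (h : ∀ l, ∀ f ∈ I, f.IsHomogeneous l → f ∈ J) : I ≤ J := fun f hf =>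
  mem_of_homogeneousComponent_mem fun e => h e _ (hI f hf e) (homogeneousComponent_isHomogeneous e f)

theorem isGraded_bot : IsGraded (⊥ : Ideal (MvPolynomial σ k)) := by
  intro f hf e
  rw [Ideal.mem_bot] at hf
  simp [hf]

theorem isGraded_top : IsGraded (⊤ : Ideal (MvPolynomial σ k)) := fun _ _ _ => trivial

theorem IsGraded.sup {I J : Ideal (MvPolynomial σ k)} (hI : IsGraded I) (hJ : IsGraded J) :
    IsGraded (I ⊔ J) := by
  intro f hf e
  obtain ⟨a, ha, b, hb, rfl⟩ := Submodule.mem_sup.1 hf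
  rw [map_add]
  exact Submodule.add_mem_sup (hI a ha e) (hJ b hb e)

theorem isGraded_span_singleton {u : MvPolynomial σ k} {c : ℕ} (hu : u.IsHomogeneous c) :
    IsGraded (Ideal.span {u}) := by
  intro f hf e
  obtain ⟨a, rfl⟩ := Ideal.mem_span_singleton'.1 hf
  rcases le_or_gt c e with h | h
  · obtain ⟨l, rfl⟩ := Nat.exists_eq_add_of_le' h
    rw [homogeneousComponent_mul_of_homogeneous hu]
    exact Ideal.mem_span_singleton'.2 ⟨_, rfl⟩
  · rw [homogeneousComponent_mul_of_lt hu _ h]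
    exact zero_mem _

theorem IsGraded.sup_span {I : Ideal (MvPolynomial σ k)} (hI : IsGraded I)
    {u : MvPolynomial σ k} {c : ℕ} (hu : u.IsHomogeneous c) : IsGraded (I ⊔ Ideal.span {u}) :=
  hI.sup (isGraded_span_singleton hu)

theorem IsGraded.quot {I : Ideal (MvPolynomial σ k)} (hI : IsGraded I)
    {u : MvPolynomial σ k} {c : ℕ} (hu : u.IsHomogeneous c) : IsGraded (quot I u) := by
  intro f hf e
  rw [mem_quot, mul_comm] at *
  rw [← homogeneousComponent_mul_of_homogeneous hu]
  exact hI _ hf _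

theorem IsGraded.mem_sup_span_iff {I : Ideal (MvPolynomial σ k)} (hI : IsGraded I)
    {u z : MvPolynomial σ k} {c l : ℕ} (hu : u.IsHomogeneous c) (hz : z.IsHomogeneous (l + c)) :
    z ∈ I ⊔ Ideal.span {u} ↔ ∃ a : MvPolynomial σ k, a.IsHomogeneous l ∧ z - a * u ∈ I := by
  rw [mem_sup_span]
  constructor
  · rintro ⟨a, ha⟩
    refine ⟨homogeneousComponent l a, homogeneousComponent_isHomogeneous l a, ?_⟩
    have := hI _ ha (l + c)
    rwa [map_sub, homogeneousComponent_mul_of_homogeneous hu, homogeneousComponent_self hz] at this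
  · rintro ⟨a, -, ha⟩
    exact ⟨a, ha⟩

theorem IsGraded.mem_of_mem_sup_span_of_lt {I : Ideal (MvPolynomial σ k)} (hI : IsGraded I)
    {u z : MvPolynomial σ k} {c l : ℕ} (hu : u.IsHomogeneous c) (hz : z.IsHomogeneous l)
    (hl : l < c) (h : z ∈ I ⊔ Ideal.span {u}) : z ∈ I := by
  obtain ⟨a, ha⟩ := mem_sup_span.1 h
  have := hI _ ha l
  rwa [map_sub, homogeneousComponent_mul_of_lt hu _ hl, homogeneousComponent_self hz, sub_zero]
    at this

/-- The degree `l` part of an ideal. -/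
noncomputable def gr (I : Ideal (MvPolynomial σ k)) (l : ℕ) : Submodule k (MvPolynomial σ k) :=
  I.restrictScalars k ⊓ homogeneousSubmodule σ k l

theorem mem_gr {I : Ideal (MvPolynomial σ k)} {l : ℕ} {f : MvPolynomial σ k} :
    f ∈ gr I l ↔ f ∈ I ∧ f.IsHomogeneous l := Iff.rfl

theorem gr_mono {I J : Ideal (MvPolynomial σ k)} (h : I ≤ J) (l : ℕ) : gr I l ≤ gr J l :=
  fun _ hf => ⟨h hf.1, hf.2⟩

theorem IsGraded.le_of_gr_le {I J : Ideal (MvPolynomial σ k)} (hI : IsGraded I)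
    (h : ∀ l, gr I l ≤ gr J l) : I ≤ J :=
  hI.le_of_homogeneous fun l _ hf hl => (h l ⟨hf, hl⟩).1

/-- The Hilbert function of the quotient by `I`. -/
noncomputable def hilb (I : Ideal (MvPolynomial σ k)) (l : ℕ) : ℕ :=
  Module.finrank k ((homogeneousSubmodule σ k l).map (Ideal.Quotient.mkₐ k I).toLinearMap)

theorem finrank_map_mul {u : MvPolynomial σ k} (hu : u ≠ 0) (V : Submodule k (MvPolynomial σ k)) :
    Module.finrank k (V.map (LinearMap.mulRight k u)) = Module.finrank k V :=
  (Submodule.equivMapOfInjective _ (fun a b h => mul_right_cancel₀ hu (by simpa using h)) V).symm.finrank_eq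

/-- The Hilbert series of the quotient by `I`. -/
noncomputable def HS (I : Ideal (MvPolynomial σ k)) : PowerSeries ℤ :=
  PowerSeries.mk fun l => (hilb I l : ℤ)

theorem coeff_HS (I : Ideal (MvPolynomial σ k)) (l : ℕ) :
    PowerSeries.coeff l (HS I) = (hilb I l : ℤ) := PowerSeries.coeff_mk _ _

theorem hilb_eq_of_HS_eq {I : Ideal (MvPolynomial σ k)}
    {J : Ideal (MvPolynomial σ k)} (h : HS I = HS J) (l : ℕ) : hilb I l = hilb J l := by
  have := congrArg (PowerSeries.coeff l) h
  rw [coeff_HS, coeff_HS] at this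
  exact_mod_cast this

variable [Finite σ]

instance finite_homogeneousSubmodule (l : ℕ) : FiniteDimensional k (homogeneousSubmodule σ k l) :=
  Module.Finite.iff_fg.2 (homogeneousSubmodule_fg σ k l)

instance finite_gr (I : Ideal (MvPolynomial σ k)) (l : ℕ) : FiniteDimensional k (gr I l) :=
  Submodule.finiteDimensional_inf_right _ _

theorem hilb_add_finrank (I : Ideal (MvPolynomial σ k)) (l : ℕ) :
    hilb I l + Module.finrank k (gr I l) = Module.finrank k (homogeneousSubmodule σ k l) := by
  have h := LinearMap.finrank_range_add_finrank_ker
    ((Ideal.Quotient.mkₐ k I).toLinearMap.domRestrict (homogeneousSubmodule σ k l))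
  rw [LinearMap.range_domRestrict] at h
  rw [← h, hilb]
  congr 1
  have : (LinearMap.ker ((Ideal.Quotient.mkₐ k I).toLinearMap.domRestrict
      (homogeneousSubmodule σ k l))).map (homogeneousSubmodule σ k l).subtype = gr I l := by
    ext f
    simp only [Submodule.mem_map, LinearMap.mem_ker, LinearMap.domRestrict_apply,
      Submodule.subtype_apply, Subtype.exists, exists_and_right, exists_eq_right, mem_gr]
    constructor
    · rintro ⟨h1, h2⟩
      exact ⟨Ideal.Quotient.eq_zero_iff_mem.1 h2, h1⟩
    · rintro ⟨h1, h2⟩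
      exact ⟨h2, Ideal.Quotient.eq_zero_iff_mem.2 h1⟩
  rw [← this]
  exact (Submodule.equivMapOfInjective _ (Submodule.injective_subtype _) _).symm.finrank_eq

theorem hilb_anti {I J : Ideal (MvPolynomial σ k)} (h : I ≤ J) (l : ℕ) : hilb J l ≤ hilb I l := by
  have h1 := hilb_add_finrank I l
  have h2 := hilb_add_finrank J l
  have h3 := Submodule.finrank_mono (gr_mono h l)
  omega

theorem gr_eq_of_hilb_eq {I J : Ideal (MvPolynomial σ k)} {l : ℕ} (h : gr I l ≤ gr J l)
    (he : hilb I l ≤ hilb J l) : gr I l = gr J l := by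
  have h1 := hilb_add_finrank I l
  have h2 := hilb_add_finrank J l
  exact Submodule.eq_of_le_of_finrank_le h (by omega)

theorem hilb_eq_of_gr_eq {I J : Ideal (MvPolynomial σ k)} {l : ℕ} (h : gr I l = gr J l) :
    hilb I l = hilb J l := by
  have h1 := hilb_add_finrank I l
  have h2 := hilb_add_finrank J l
  rw [h] at h1
  omega

theorem eq_of_hilb_eq {I J : Ideal (MvPolynomial σ k)} (hJ : IsGraded J) (h : I ≤ J)
    (he : ∀ l, hilb I l ≤ hilb J l) : I = J :=
  le_antisymm h (hJ.le_of_gr_le fun l => (gr_eq_of_hilb_eq (gr_mono h l) (he l)).ge)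

theorem hilb_eq_zero_iff {I : Ideal (MvPolynomial σ k)} {l : ℕ} :
    hilb I l = 0 ↔ ∀ f : MvPolynomial σ k, f.IsHomogeneous l → f ∈ I := by
  have h1 := hilb_add_finrank I l
  constructor
  · intro h f hf
    have : gr I l = homogeneousSubmodule σ k l :=
      Submodule.eq_of_le_of_finrank_le (fun f hf => hf.2) (by omega)
    exact (this.ge hf).1
  · intro h
    have : gr I l = homogeneousSubmodule σ k l :=
      le_antisymm (fun f hf => hf.2) fun f hf => ⟨h f hf, hf⟩
    rw [this] at h1
    omega

theorem hilb_top (l : ℕ) : hilb (⊤ : Ideal (MvPolynomial σ k)) l = 0 :=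
  hilb_eq_zero_iff.2 fun _ _ => trivial

theorem exists_of_hilb_lt {I J : Ideal (MvPolynomial σ k)} {l : ℕ} (h : hilb J l < hilb I l) :
    ∃ f ∈ J, f.IsHomogeneous l ∧ f ∉ I := by
  by_contra! hc
  have h1 := hilb_add_finrank I l
  have h2 := hilb_add_finrank J l
  have := Submodule.finrank_mono (show gr J l ≤ gr I l from fun f hf => ⟨hc f hf.1 hf.2, hf.2⟩)
  omega

/-- The exact sequence `0 → A/(I : u)(-c) → A/I → A/(I + u) → 0` in degree `l + c`. -/
theorem hilb_sup_span_add {I : Ideal (MvPolynomial σ k)} (hI : IsGraded I)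
    {u : MvPolynomial σ k} {c : ℕ} (hu : u.IsHomogeneous c) (l : ℕ) :
    hilb (I ⊔ Ideal.span {u}) (l + c) + hilb (quot I u) l = hilb I (l + c) := by
  rcases eq_or_ne u 0 with rfl | h0
  · have : quot I 0 = ⊤ := by ext z; simp [mem_quot]
    simp [this, hilb_top]
  have h1 := hilb_add_finrank I (l + c)
  have h2 := hilb_add_finrank (I ⊔ Ideal.span {u}) (l + c)
  have h3 := hilb_add_finrank (quot I u) l
  have h4 := Submodule.finrank_sup_add_finrank_inf_eq (gr I (l + c))
    ((homogeneousSubmodule σ k l).map (LinearMap.mulRight k u))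
  have h5 : gr I (l + c) ⊔ (homogeneousSubmodule σ k l).map (LinearMap.mulRight k u) =
      gr (I ⊔ Ideal.span {u}) (l + c) := by
    apply le_antisymm
    · refine sup_le (gr_mono le_sup_left _) ?_
      rintro _ ⟨a, ha, rfl⟩
      exact ⟨Ideal.mem_sup_right (Ideal.mem_span_singleton'.2 ⟨a, rfl⟩), IsHomogeneous.mul ha hu⟩
    · rintro z ⟨hz, hzl⟩
      obtain ⟨a, ha, haz⟩ := (hI.mem_sup_span_iff hu hzl).1 hz
      rw [← sub_add_cancel z (a * u)]
      exact Submodule.add_mem_sup ⟨haz, IsHomogeneous.sub hzl (ha.mul hu)⟩ ⟨a, ha, rfl⟩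
  have h6 : gr I (l + c) ⊓ (homogeneousSubmodule σ k l).map (LinearMap.mulRight k u) =
      (gr (quot I u) l).map (LinearMap.mulRight k u) := by
    ext z
    constructor
    · rintro ⟨hz, a, ha, rfl⟩
      exact ⟨a, ⟨by rw [SetLike.mem_coe, Submodule.restrictScalars_mem, mem_quot, mul_comm]; exact hz.1, ha⟩, rfl⟩
    · rintro ⟨a, ha, rfl⟩
      exact ⟨⟨by have := mem_quot.1 ha.1; rw [mul_comm] at this; exact this,
        IsHomogeneous.mul ha.2 hu⟩, a, ha.2, rfl⟩
  rw [h5, h6, finrank_map_mul h0, finrank_map_mul h0] at h4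
  omega

theorem hilb_sup_span_of_lt {I : Ideal (MvPolynomial σ k)} (hI : IsGraded I)
    {u : MvPolynomial σ k} {c l : ℕ} (hu : u.IsHomogeneous c) (hl : l < c) :
    hilb (I ⊔ Ideal.span {u}) l = hilb I l :=
  hilb_eq_of_gr_eq <| le_antisymm
    (fun _ hf => ⟨hI.mem_of_mem_sup_span_of_lt hu hf.2 hl hf.1, hf.2⟩) (gr_mono le_sup_left _)

theorem HS_sup_span {I : Ideal (MvPolynomial σ k)} (hI : IsGraded I)
    {u : MvPolynomial σ k} {c : ℕ} (hu : u.IsHomogeneous c) :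
    HS (I ⊔ Ideal.span {u}) = HS I - PowerSeries.X ^ c * HS (quot I u) := by
  ext l
  rw [map_sub, PowerSeries.coeff_X_pow_mul', coeff_HS, coeff_HS]
  split_ifs with h
  · obtain ⟨m, rfl⟩ := Nat.exists_eq_add_of_le' h
    rw [coeff_HS, Nat.add_sub_cancel, ← hilb_sup_span_add hI hu m]
    push_cast; ring
  · rw [hilb_sup_span_of_lt hI hu (by omega), sub_zero]

theorem Reg.HS_sup_span {I : Ideal (MvPolynomial σ k)} (hI : IsGraded I)
    {u : MvPolynomial σ k} {c : ℕ} (hu : u.IsHomogeneous c) (h : Reg I u) :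
    HS (I ⊔ Ideal.span {u}) = (1 - PowerSeries.X ^ c) * HS I := by
  rw [GradedIdeal.HS_sup_span hI hu, h.quot_eq]; ring

theorem eq_of_HS_eq {I J : Ideal (MvPolynomial σ k)} (hJ : IsGraded J) (h : I ≤ J)
    (he : HS I = HS J) : I = J :=
  eq_of_hilb_eq hJ h fun l => (hilb_eq_of_HS_eq he l).le

/-- The exact sequence turns the hypothesis into equality of the series of I and of (I : u), and
nested graded ideals with the same series coincide. Regularity can thus be read off numerically
after a section. -/
theorem reg_of_HS {I : Ideal (MvPolynomial σ k)} (hI : IsGraded I)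
    {u : MvPolynomial σ k} {c : ℕ} (hu : u.IsHomogeneous c)
    (h : HS (I ⊔ Ideal.span {u}) = (1 - PowerSeries.X ^ c) * HS I) : Reg I u := by
  rw [GradedIdeal.HS_sup_span hI hu] at h
  have h2 : (PowerSeries.X ^ c : PowerSeries ℤ) * HS I = PowerSeries.X ^ c * HS (quot I u) := by
    linear_combination h
  have h3 := mul_left_cancel₀ (pow_ne_zero _ PowerSeries.X_ne_zero) h2
  have := eq_of_HS_eq (hI.quot hu) (le_quot I u) h3
  intro z hz
  rw [this]
  exact hz

end GradedIdeal

/-! ### Depth, and general linear forms as nonzerodivisors. -/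

namespace GradedIdeal

variable {σ k : Type*} [Field k]

theorem reg_iff_isSMulRegular {R : Type*} [CommRing R] {I : Ideal R} {f : R} :
    Reg I f ↔ IsSMulRegular (R ⧸ I) f := by
  rw [isSMulRegular_iff_right_eq_zero_of_smul]
  constructor
  · intro h z
    obtain ⟨z, rfl⟩ := Ideal.Quotient.mk_surjective z
    intro hz
    rw [Ideal.Quotient.eq_zero_iff_mem]
    exact h z (Ideal.Quotient.eq_zero_iff_mem.1 hz)
  · intro h z hz
    exact Ideal.Quotient.eq_zero_iff_mem.1
      (h (Ideal.Quotient.mk I z) (Ideal.Quotient.eq_zero_iff_mem.2 hz))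

/-- Multiplying by the irrelevant ideal detects membership in `I`. -/
def NoSocle (I : Ideal (MvPolynomial σ k)) : Prop := ∀ z, (∀ i, X i * z ∈ I) → z ∈ I

/-- `I` admits a regular sequence of length `m` inside the irrelevant ideal. -/
def DepthGE : ℕ → Ideal (MvPolynomial σ k) → Prop
  | 0, _ => True
  | m + 1, I => ∃ f ∈ idealOfVars σ k, Reg I f ∧ DepthGE m (I ⊔ Ideal.span {f})

theorem mem_idealOfVars_of_homogeneous {f : MvPolynomial σ k} {e : ℕ} (he : 0 < e)
    (hf : f.IsHomogeneous e) : f ∈ idealOfVars σ k := by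
  rw [idealOfVars, ← Set.image_univ, mem_ideal_span_X_image]
  intro m hm
  by_contra! h
  have h0 : m = 0 := by ext i; simpa using h i
  have := hf.degree_eq_sum_deg_support hm
  simp [h0] at this
  omega

theorem mul_mem_of_mem_idealOfVars {I : Ideal (MvPolynomial σ k)} {f z : MvPolynomial σ k}
    (hf : f ∈ idealOfVars σ k) (hz : ∀ i, X i * z ∈ I) : f * z ∈ I := by
  have : idealOfVars σ k ≤ quot I z := by
    rw [idealOfVars, Ideal.span_le]
    rintro _ ⟨i, rfl⟩
    rw [SetLike.mem_coe, mem_quot, mul_comm]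
    exact hz i
  have h := mem_quot.1 (this hf)
  rwa [mul_comm] at h

theorem Reg.noSocle {I : Ideal (MvPolynomial σ k)} {f : MvPolynomial σ k}
    (hf : f ∈ idealOfVars σ k) (h : Reg I f) : NoSocle I :=
  fun z hz => h z (mul_mem_of_mem_idealOfVars hf hz)

theorem DepthGE.noSocle {I : Ideal (MvPolynomial σ k)} {m : ℕ} (h : DepthGE (m + 1) I) :
    NoSocle I := by
  obtain ⟨f, hf, hr, -⟩ := h
  exact hr.noSocle hf

/-- For nonzerodivisors f, g modulo I, a socle element z modulo I + (f) gives gz = wf modulo I, and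
w is then a socle element modulo I + (g). This exchange replaces the Ext characterization of depth.
-/
theorem NoSocle.exchange {I : Ideal (MvPolynomial σ k)} {f g : MvPolynomial σ k}
    (hg : g ∈ idealOfVars σ k) (hfr : Reg I f) (hgr : Reg I g)
    (h : NoSocle (I ⊔ Ideal.span {g})) : NoSocle (I ⊔ Ideal.span {f}) := by
  intro z hz
  obtain ⟨w, hw⟩ := mem_sup_span.1 (mul_mem_of_mem_idealOfVars hg hz)
  have hw' : w ∈ I ⊔ Ideal.span {g} := by
    refine h w fun i => ?_
    obtain ⟨t, ht⟩ := mem_sup_span.1 (hz i)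
    refine mem_sup_span.2 ⟨t, hfr _ ?_⟩
    have : f * (X i * w - t * g) = g * (X i * z - t * f) - X i * (g * z - w * f) := by ring
    rw [this]
    exact I.sub_mem (I.mul_mem_left _ ht) (I.mul_mem_left _ hw)
  obtain ⟨v, hv⟩ := mem_sup_span.1 hw'
  refine mem_sup_span.2 ⟨v, hgr _ ?_⟩
  have : g * (z - v * f) = (g * z - w * f) + f * (w - v * g) := by ring
  rw [this]
  exact I.add_mem hw (I.mul_mem_left _ hv)

theorem Reg.swap {R : Type*} [CommRing R] {I : Ideal R} {f g : R} (hf : Reg I f)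
    (hgf : Reg (I ⊔ Ideal.span {f}) g) : Reg (I ⊔ Ideal.span {g}) f := by
  intro z hz
  obtain ⟨w, hw⟩ := mem_sup_span.1 hz
  have h1 : w ∈ I ⊔ Ideal.span {f} := by
    refine hgf w (mem_sup_span.2 ⟨z, ?_⟩)
    have := I.neg_mem hw
    convert this using 1
    ring
  obtain ⟨v, hv⟩ := mem_sup_span.1 h1
  refine mem_sup_span.2 ⟨v, hf _ ?_⟩
  have : f * (z - v * g) = (f * z - w * g) + g * (w - v * f) := by ring
  rw [this]
  exact I.add_mem hw (I.mul_mem_left _ hv)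

theorem reg_top {R : Type*} [CommRing R] (f : R) : Reg ⊤ f := fun _ _ => trivial

theorem depthGE_top (m : ℕ) : DepthGE m (⊤ : Ideal (MvPolynomial σ k)) := by
  induction m with
  | zero => trivial
  | succ m ih => exact ⟨0, zero_mem _, reg_top _, by rwa [top_sup_eq]⟩

variable [Finite σ]

/-- Prime avoidance for vector spaces: each associated prime meets the linear forms in a proper
subspace, since one containing all variables would produce a socle element, and finitely many proper
subspaces do not cover a space over an infinite field. -/
theorem exists_linear_reg [Infinite k] {S : Set (Ideal (MvPolynomial σ k))} (hS : S.Finite)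
    (h : ∀ I ∈ S, NoSocle I) :
    ∃ L : MvPolynomial σ k, L.IsHomogeneous 1 ∧ ∀ I ∈ S, Reg I L := by
  classical
  set T : Set (Ideal (MvPolynomial σ k)) :=
    ⋃ I ∈ S, associatedPrimes (MvPolynomial σ k) (MvPolynomial σ k ⧸ I) with hT
  have hTf : T.Finite := hS.biUnion fun I _ => associatedPrimes.finite _ _
  let V : Ideal (MvPolynomial σ k) → Subspace k (homogeneousSubmodule σ k 1) := fun P =>
    (P.restrictScalars k).comap (homogeneousSubmodule σ k 1).subtype
  have hV : ∀ P ∈ T, V P ≠ ⊤ := by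
    intro P hP hVP
    obtain ⟨I, hI, hPI⟩ := Set.mem_iUnion₂.1 hP
    obtain ⟨hprime, x, hx⟩ := hPI
    obtain ⟨z, rfl⟩ := Ideal.Quotient.mk_surjective x
    have hX : ∀ i, (X i : MvPolynomial σ k) ∈ P := fun i => by
      have : (⟨X i, isHomogeneous_X k i⟩ : homogeneousSubmodule σ k 1) ∈ V P := by
        rw [hVP]; trivial
      exact this
    have hsoc : ∃ y, (∀ i, X i * y ∈ I) ∧ y ∉ I := by
      obtain ⟨N, hN⟩ : ∃ N, P ^ N ≤ (⊥ : Submodule (MvPolynomial σ k) (MvPolynomial σ k ⧸ I)).colon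
          {Ideal.Quotient.mk I z} := by
        rw [hx]
        exact Ideal.exists_radical_pow_le_of_fg _ (IsNoetherian.noetherian _)
      have hz : z ∉ I := by
        intro hz
        have : (1 : MvPolynomial σ k) ∈ P := by
          rw [hx, Ideal.Quotient.eq_zero_iff_mem.2 hz]
          exact ⟨1, by simp [Submodule.mem_colon]⟩
        exact hprime.ne_top ((Ideal.eq_top_iff_one _).2 this)
      -- As P^N kills z, multiplying z by variables as long as the product stays outside I ends,
      -- after fewer than N steps, at a socle element.
      have key : ∀ N : ℕ, ∀ z, z ∉ I → (∀ f ∈ P ^ N, f * z ∈ I) →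
          ∃ y, (∀ i, X i * y ∈ I) ∧ y ∉ I := by
        intro N
        induction N with
        | zero => intro z hz hN; exact absurd (by simpa using hN 1 (by simp)) hz
        | succ N ih =>
          intro z hz hN
          by_cases hc : ∃ i, X i * z ∉ I
          · obtain ⟨i, hi⟩ := hc
            refine ih _ hi fun f hf => ?_
            rw [← mul_assoc]
            refine hN _ ?_
            rw [pow_succ]
            exact Ideal.mul_mem_mul hf (hX i)
          · push Not at hc
            exact ⟨z, hc, hz⟩
      refine key N z hz fun f hf => ?_
      have := hN hf
      rw [Submodule.mem_colon] at this
      have h2 := this _ (Set.mem_singleton _)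
      exact Ideal.Quotient.eq_zero_iff_mem.1 h2
    obtain ⟨y, hy, hyI⟩ := hsoc
    exact hyI (h I hI y hy)
  have hne := Subspace.biUnion_ne_univ_of_top_notMem (s := hTf.toFinset.image V) (by
    rw [Finset.mem_image]
    rintro ⟨P, hP, hVP⟩
    exact hV P (hTf.mem_toFinset.1 hP) hVP)
  obtain ⟨L, hL⟩ := (Set.ne_univ_iff_exists_notMem _).1 hne
  refine ⟨L.1, L.2, fun I hI => reg_iff_isSMulRegular.2 ?_⟩
  by_contra hc
  have h1 : L.1 ∈ {r | IsSMulRegular (MvPolynomial σ k ⧸ I) r}ᶜ := hc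
  rw [← biUnion_associatedPrimes_eq_compl_regular] at h1
  obtain ⟨P, hP, hLP⟩ := Set.mem_iUnion₂.1 h1
  exact hL (Set.mem_iUnion₂.2 ⟨V P, Finset.mem_image_of_mem _
    (hTf.mem_toFinset.2 (Set.mem_iUnion₂.2 ⟨I, hI, hP⟩)), hLP⟩)

/-- Depth drops by at most one modulo any nonzerodivisor. -/
theorem DepthGE.sup_span [Infinite k] {m : ℕ} : ∀ {I : Ideal (MvPolynomial σ k)}
    {f : MvPolynomial σ k}, DepthGE (m + 1) I → Reg I f → DepthGE m (I ⊔ Ideal.span {f}) := by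
  induction m with
  | zero => intros; trivial
  | succ m ih =>
    intro I f hI hf
    obtain ⟨g, hg, hgr, hgd⟩ := id hI
    have hs : NoSocle (I ⊔ Ideal.span {f}) := NoSocle.exchange hg hf hgr hgd.noSocle
    -- L is chosen regular modulo both I + (g) and I + (f). Swapping it to the front lets the
    -- induction hypothesis act modulo I + (L), with f still a nonzerodivisor there.
    obtain ⟨L, hL, hLr⟩ := exists_linear_reg
      (S := {I ⊔ Ideal.span {g}, I ⊔ Ideal.span {f}}) (by simp) (by
        rintro J (rfl | rfl)
        exacts [hgd.noSocle, hs])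
    have hLm := mem_idealOfVars_of_homogeneous one_pos hL
    have hLg := hLr (I ⊔ Ideal.span {g}) (by simp)
    have hLf := hLr (I ⊔ Ideal.span {f}) (by simp)
    have h1 : DepthGE (m + 1) (I ⊔ Ideal.span {L}) :=
      ⟨g, hg, hgr.swap hLg, by rw [sup_right_comm]; exact ih hgd hLg⟩
    refine ⟨L, hLm, hLf, ?_⟩
    rw [sup_right_comm]
    exact ih h1 (hf.swap hLf)

end GradedIdeal

/-! ### Sections by general linear forms, and the series of the polynomial ring. -/

namespace GradedIdeal

variable {σ k : Type*} [Field k]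

theorem ringKrullDim_sup_span_add_one_le {R : Type*} [CommRing R] {I : Ideal R} {f : R}
    (h : Reg I f) : ringKrullDim (R ⧸ I ⊔ Ideal.span {f}) + 1 ≤ ringKrullDim (R ⧸ I) := by
  have h1 : Ideal.Quotient.mk I f ∈ nonZeroDivisors (R ⧸ I) := by
    rw [mem_nonZeroDivisors_iff_right]
    intro z
    obtain ⟨z, rfl⟩ := Ideal.Quotient.mk_surjective z
    intro hz
    rw [← map_mul, Ideal.Quotient.eq_zero_iff_mem, mul_comm] at hz
    exact Ideal.Quotient.eq_zero_iff_mem.2 (h z hz)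
  have h2 := ringKrullDim_quotient_succ_le_of_nonZeroDivisor h1
  rw [← ringKrullDim_eq_of_ringEquiv (DoubleQuot.quotQuotEquivQuotSup I (Ideal.span {f})),
    Ideal.map_span, Set.image_singleton]
  exact h2

/-- Graded Nakayama: an element of I is af modulo J, regularity puts a in I, and a has smaller
degree, so induction applies. -/
theorem Reg.eq_of_sup_span_eq {I J : Ideal (MvPolynomial σ k)} {f : MvPolynomial σ k}
    (hI : IsGraded I) (hJ : IsGraded J) (hf : f.IsHomogeneous 1) (hr : Reg I f) (hJI : J ≤ I)
    (h : J ⊔ Ideal.span {f} = I ⊔ Ideal.span {f}) : J = I := by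
  refine le_antisymm hJI (hI.le_of_homogeneous fun l => ?_)
  induction l with
  | zero =>
    intro z hz hzl
    exact hJ.mem_of_mem_sup_span_of_lt hf hzl one_pos (h ▸ Ideal.mem_sup_left hz)
  | succ l ih =>
    intro z hz hzl
    obtain ⟨a, ha, haz⟩ := (hJ.mem_sup_span_iff hf hzl).1 (h ▸ Ideal.mem_sup_left hz)
    have h1 : a ∈ I := by
      refine hr a ?_
      have := I.sub_mem hz (hJI haz)
      rwa [sub_sub_cancel, mul_comm] at this
    have := J.add_mem haz (J.mul_mem_right f (ih a h1 ha))
    rwa [sub_add_cancel] at this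

/-- `K` cuts `I` like an ideal generated by `m` linear forms that are a regular sequence
modulo `I`. -/
structure IsLinearSection (m : ℕ) (K I : Ideal (MvPolynomial σ k)) : Prop where
  HS_eq : HS (I ⊔ K) = (1 - PowerSeries.X) ^ m * HS I
  dim_le : ringKrullDim (MvPolynomial σ k ⧸ I ⊔ K) + (m : ℕ) ≤ ringKrullDim (MvPolynomial σ k ⧸ I)
  nakayama : ∀ J ≤ I, IsGraded J → J ⊔ K = I ⊔ K → J = I
  depth : ∀ j, DepthGE (m + j) I → DepthGE j (I ⊔ K)

theorem reg_span_X {s : Set σ} {i : σ} (hi : i ∉ s) :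
    Reg (Ideal.span ((X : σ → MvPolynomial σ k) '' s)) (X i) := by
  classical
  intro z hz
  rw [mem_ideal_span_X_image] at hz ⊢
  intro m hm
  obtain ⟨j, hj, hmj⟩ := hz (Finsupp.single i 1 + m) (by
    rw [mem_support_iff, coeff_X_mul]
    exact mem_support_iff.1 hm)
  have hij : i ≠ j := fun h => hi (h ▸ hj)
  exact ⟨j, hj, by simpa [Finsupp.single_apply, hij] using hmj⟩

theorem span_X_image_insert (s : Set σ) (i : σ) :
    Ideal.span ((X : σ → MvPolynomial σ k) '' insert i s) =
      Ideal.span (X '' s) ⊔ Ideal.span {X i} := by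
  rw [Set.image_insert_eq, Ideal.span_insert, sup_comm]

theorem depthGE_span_X [Fintype σ] (s : Finset σ) :
    DepthGE (Fintype.card σ - s.card) (Ideal.span ((X : σ → MvPolynomial σ k) '' s)) := by
  classical
  induction hn : Fintype.card σ - s.card generalizing s with
  | zero => trivial
  | succ n ih =>
    obtain ⟨i, hi⟩ : ∃ i, i ∉ s := by
      by_contra! hc
      have : s = Finset.univ := by ext; simp [hc]
      rw [this, Finset.card_univ] at hn
      omega
    refine ⟨X i, Ideal.subset_span ⟨i, rfl⟩, reg_span_X (by simpa using hi), ?_⟩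
    have := ih (insert i s) (by rw [Finset.card_insert_of_notMem hi]; omega)
    rwa [Finset.coe_insert, span_X_image_insert] at this

theorem depthGE_bot [Fintype σ] :
    DepthGE (Fintype.card σ) (⊥ : Ideal (MvPolynomial σ k)) := by
  simpa using depthGE_span_X (k := k) (∅ : Finset σ)

variable [Finite σ]

theorem exists_isLinearSection [Infinite k] (m : ℕ) : ∀ {S : Set (Ideal (MvPolynomial σ k))},
    S.Finite → (∀ I ∈ S, IsGraded I) → (∀ I ∈ S, DepthGE m I) →
    ∃ K : Ideal (MvPolynomial σ k), IsGraded K ∧ ∀ I ∈ S, IsLinearSection m K I := by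
  induction m with
  | zero =>
    intro S _ _ _
    refine ⟨⊥, isGraded_bot, fun I _ => ⟨?_, ?_, ?_, ?_⟩⟩
    · simp
    · rw [sup_bot_eq, Nat.cast_zero, add_zero]
    · intro J _ _ h; simpa using h
    · intro j h; simpa using h
  | succ m ih =>
    intro S hS hg hd
    obtain ⟨L, hL, hLr⟩ := exists_linear_reg hS fun I hI => (hd I hI).noSocle
    obtain ⟨K, hK, hKS⟩ := ih (hS.image fun I => I ⊔ Ideal.span {L})
      (by rintro _ ⟨I, hI, rfl⟩; exact (hg I hI).sup_span hL)
      (by rintro _ ⟨I, hI, rfl⟩; exact (hd I hI).sup_span (hLr I hI))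
    refine ⟨Ideal.span {L} ⊔ K, (isGraded_span_singleton hL).sup hK, fun I hI => ?_⟩
    have hs := hKS _ ⟨I, hI, rfl⟩
    have hr := hLr I hI
    simp only at hs
    refine ⟨?_, ?_, ?_, ?_⟩
    · rw [← sup_assoc, hs.HS_eq, hr.HS_sup_span (hg I hI) hL]
      ring
    · rw [← sup_assoc]
      refine le_trans ?_ (ringKrullDim_sup_span_add_one_le hr)
      refine le_trans ?_ (add_le_add_left hs.dim_le 1)
      rw [add_assoc]
      norm_cast
    · intro J hJ hJg h
      rw [← sup_assoc, ← sup_assoc] at h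
      exact hr.eq_of_sup_span_eq (hg I hI) hJg hL hJ
        (hs.nakayama _ (sup_le_sup_right hJ _) (hJg.sup_span hL) h)
    · intro j hj
      rw [← sup_assoc]
      refine hs.depth j (DepthGE.sup_span ?_ hr)
      rwa [add_right_comm]

/-! ### The polynomial ring itself -/

theorem isGraded_span_X (s : Set σ) : IsGraded (Ideal.span ((X : σ → MvPolynomial σ k) '' s)) := by
  induction s, s.toFinite using Set.Finite.induction_on with
  | empty => simpa using isGraded_bot
  | @insert i s _ _ ih =>
    rw [span_X_image_insert]
    exact ih.sup_span (isHomogeneous_X k i)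

theorem HS_span_X (s : Finset σ) :
    HS (Ideal.span ((X : σ → MvPolynomial σ k) '' s)) =
      (1 - PowerSeries.X) ^ s.card * HS (⊥ : Ideal (MvPolynomial σ k)) := by
  classical
  induction s using Finset.induction_on with
  | empty => simp
  | @insert i s hi ih =>
    rw [Finset.coe_insert, span_X_image_insert,
      (reg_span_X (by simpa using hi)).HS_sup_span (isGraded_span_X _) (isHomogeneous_X k i), ih,
      Finset.card_insert_of_notMem hi, pow_succ]
    ring

theorem HS_idealOfVars : HS (idealOfVars σ k) = 1 := by
  ext l
  rw [coeff_HS, PowerSeries.coeff_one]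
  split_ifs with h
  · subst h
    have h1 := hilb_add_finrank (idealOfVars σ k) 0
    have h2 : gr (idealOfVars σ k) 0 = ⊥ := by
      rw [eq_bot_iff]
      rintro f ⟨hf, hf0⟩
      rw [homogeneousSubmodule_zero] at hf0
      obtain ⟨c, rfl⟩ := Submodule.mem_one.1 hf0
      have : c = 0 := by
        by_contra hc
        rw [SetLike.mem_coe, Submodule.restrictScalars_mem, idealOfVars, ← Set.image_univ,
          mem_ideal_span_X_image] at hf
        obtain ⟨i, -, hi⟩ := hf 0 (by simpa [mem_support_iff] using hc)
        exact hi rfl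
      simp [this]
    rw [h2, finrank_bot, homogeneousSubmodule_zero, add_zero] at h1
    rw [h1, Submodule.one_eq_range, LinearMap.finrank_range_of_inj]
    · simp
    · exact (algebraMap k (MvPolynomial σ k)).injective
  · rw [Nat.cast_eq_zero, hilb_eq_zero_iff]
    intro f hf
    exact mem_idealOfVars_of_homogeneous (Nat.pos_of_ne_zero h) hf

theorem HS_bot [Fintype σ] :
    (1 - PowerSeries.X) ^ Fintype.card σ * HS (⊥ : Ideal (MvPolynomial σ k)) = 1 := by
  have h := HS_span_X (k := k) (Finset.univ : Finset σ)
  rw [Finset.coe_univ, Set.image_univ, Finset.card_univ] at h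
  rw [← h, ← HS_idealOfVars (σ := σ) (k := k), idealOfVars]

end GradedIdeal

/-! ### Ideals in a two-dimensional linear section. -/

namespace GradedIdeal

variable {σ k : Type*} [Field k]

/-- `K` cuts the polynomial ring down to a two-dimensional one, with linear parameters `x, y`. -/
structure IsPlane (K : Ideal (MvPolynomial σ k)) (x y : MvPolynomial σ k) : Prop where
  graded : IsGraded K
  hom_x : x.IsHomogeneous 1
  hom_y : y.IsHomogeneous 1
  reg_x : Reg K x
  reg_y : Reg (K ⊔ Ideal.span {x}) y
  vars_le : idealOfVars σ k ≤ K ⊔ Ideal.span {x} ⊔ Ideal.span {y}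
  HS_eq : (1 - PowerSeries.X) ^ 2 * HS K = 1

theorem IsPlane.noSocle {K : Ideal (MvPolynomial σ k)} {x y f : MvPolynomial σ k}
    (hP : IsPlane K x y) (hf : Reg K f) : NoSocle (K ⊔ Ideal.span {f}) :=
  NoSocle.exchange (mem_idealOfVars_of_homogeneous one_pos hP.hom_x) hf hP.reg_x
    (hP.reg_y.noSocle (mem_idealOfVars_of_homogeneous one_pos hP.hom_y))

/-- A complete intersection of type `(a, b)` in two variables has its socle in degree `a + b - 2`
only. -/
theorem IsPlane.mem_of_socle {K : Ideal (MvPolynomial σ k)} {x y f g u : MvPolynomial σ k}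
    {a b l : ℕ} (hP : IsPlane K x y) (hfa : f.IsHomogeneous a) (hgb : g.IsHomogeneous b)
    (hf : Reg K f) (hg : Reg (K ⊔ Ideal.span {f}) g) (hul : u.IsHomogeneous l) (hl : l + 2 < a + b)
    (hu : ∀ i, X i * u ∈ K ⊔ Ideal.span {f} ⊔ Ideal.span {g}) :
    u ∈ K ⊔ Ideal.span {f} ⊔ Ideal.span {g} := by
  have hKf := hP.graded.sup_span hfa
  have hxu := mul_mem_of_mem_idealOfVars (mem_idealOfVars_of_homogeneous one_pos hP.hom_x) hu
  have hyu := mul_mem_of_mem_idealOfVars (mem_idealOfVars_of_homogeneous one_pos hP.hom_y) hu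
  have hxl : (x * u).IsHomogeneous (l + 1) := by
    rw [add_comm]; exact hP.hom_x.mul hul
  have hyl : (y * u).IsHomogeneous (l + 1) := by
    rw [add_comm]; exact hP.hom_y.mul hul
  -- In degrees below b both cofactors of g are 0. Otherwise regularity of g puts yp - xq in K +
  -- (f); its degree l + 2 - b is less than a, so it lies in K.
  obtain ⟨p, q, hp, hq, hpq⟩ : ∃ p q, x * u - p * g ∈ K ⊔ Ideal.span {f} ∧
      y * u - q * g ∈ K ⊔ Ideal.span {f} ∧ y * p - x * q ∈ K := by
    rcases lt_or_ge (l + 1) b with h | h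
    · refine ⟨0, 0, ?_, ?_, by simp⟩
      · simpa using hKf.mem_of_mem_sup_span_of_lt hgb hxl h hxu
      · simpa using hKf.mem_of_mem_sup_span_of_lt hgb hyl h hyu
    · obtain ⟨t, ht⟩ := Nat.exists_eq_add_of_le' h
      rw [ht] at hxl hyl
      obtain ⟨p, hpt, hp⟩ := (hKf.mem_sup_span_iff hgb hxl).1 hxu
      obtain ⟨q, hqt, hq⟩ := (hKf.mem_sup_span_iff hgb hyl).1 hyu
      refine ⟨p, q, hp, hq, hP.graded.mem_of_mem_sup_span_of_lt hfa
        ((hP.hom_y.mul hpt).sub (hP.hom_x.mul hqt)) (by omega) (hg _ ?_)⟩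
      have : g * (y * p - x * q) = x * (y * u - q * g) - y * (x * u - p * g) := by ring
      rw [this]
      exact Ideal.sub_mem _ (Ideal.mul_mem_left _ _ hq) (Ideal.mul_mem_left _ _ hp)
  -- The Koszul relation of x, y modulo K gives (p, q) = w(x, y). Hence x and y kill u - wg modulo K
  -- + (f), which has no socle.
  obtain ⟨w, hw⟩ := mem_sup_span.1 (hP.reg_y p (mem_sup_span.2 ⟨q, by rwa [mul_comm q]⟩))
  have hw2 : q - y * w ∈ K := by
    refine hP.reg_x _ ?_
    have : x * (q - y * w) = y * (p - w * x) - (y * p - x * q) := by ring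
    rw [this]
    exact Ideal.sub_mem _ (Ideal.mul_mem_left _ _ hw) hpq
  refine mem_sup_span.2 ⟨w, hP.noSocle hf _ fun i => ?_⟩
  have hle : K ⊔ Ideal.span {x} ⊔ Ideal.span {y} ≤
      GradedIdeal.quot (K ⊔ Ideal.span {f}) (u - w * g) := by
    refine sup_le (sup_le (le_trans le_sup_left (le_quot _ _)) ?_) ?_
    · rw [Ideal.span_singleton_le_iff_mem, mem_quot]
      have : (u - w * g) * x = (x * u - p * g) + g * (p - w * x) := by ring
      rw [this]
      exact Ideal.add_mem _ hp (Ideal.mul_mem_left _ _ (Ideal.mem_sup_left hw))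
    · rw [Ideal.span_singleton_le_iff_mem, mem_quot]
      have : (u - w * g) * y = (y * u - q * g) + g * (q - y * w) := by ring
      rw [this]
      exact Ideal.add_mem _ hq (Ideal.mul_mem_left _ _ (Ideal.mem_sup_left hw2))
  have := mem_quot.1 (hle (hP.vars_le (Ideal.subset_span ⟨i, rfl⟩)))
  rwa [mul_comm] at this

/-- The ideal generated by `K` and the elements of `J` of degree at most `e`. -/
noncomputable def truncated (K J : Ideal (MvPolynomial σ k)) (e : ℕ) : Ideal (MvPolynomial σ k) :=
  K ⊔ Ideal.span {g | g ∈ J ∧ ∃ i ≤ e, g.IsHomogeneous i}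

theorem truncated_le {K J : Ideal (MvPolynomial σ k)} (h : K ≤ J) (e : ℕ) : truncated K J e ≤ J :=
  sup_le h (Ideal.span_le.2 fun _ hg => hg.1)

theorem mem_truncated {K J : Ideal (MvPolynomial σ k)} {e i : ℕ} {g : MvPolynomial σ k}
    (hg : g ∈ J) (hi : g.IsHomogeneous i) (h : i ≤ e) : g ∈ truncated K J e :=
  Ideal.mem_sup_right (Ideal.subset_span ⟨hg, i, h, hi⟩)

theorem isGraded_span {s : Set (MvPolynomial σ k)} (hs : ∀ g ∈ s, ∃ i, g.IsHomogeneous i) :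
    IsGraded (Ideal.span s) := by
  intro f hf j
  induction hf using Submodule.closure_induction with
  | zero => simp
  | add a b _ _ ha hb => rw [map_add]; exact add_mem ha hb
  | smul_mem r g hg =>
    obtain ⟨i, hgi⟩ := hs g hg
    exact isGraded_span_singleton hgi |>.le_of_homogeneous
      (fun l h hh _ => Ideal.span_mono (Set.singleton_subset_iff.2 hg) hh)
      (isGraded_span_singleton hgi _ (Ideal.mul_mem_left _ r (Ideal.mem_span_singleton_self g)) j)

theorem isGraded_truncated {K : Ideal (MvPolynomial σ k)} (hK : IsGraded K)
    (J : Ideal (MvPolynomial σ k)) (e : ℕ) : IsGraded (truncated K J e) :=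
  hK.sup (isGraded_span fun _ hg => let ⟨i, _, hi⟩ := hg.2; ⟨i, hi⟩)

/-- Above degree e there are no new generators besides K, so every coefficient of a generator has
positive degree. -/
theorem homogeneousComponent_truncated_mem {K J : Ideal (MvPolynomial σ k)} (hK : IsGraded K)
    {e j : ℕ} (hj : e < j) {w : MvPolynomial σ k} (hw : w ∈ truncated K J e) :
    homogeneousComponent j w ∈ K ⊔ idealOfVars σ k * truncated K J e := by
  obtain ⟨κ, hκ, v, hv, rfl⟩ := Submodule.mem_sup.1 hw
  rw [map_add]
  refine add_mem (Ideal.mem_sup_left (hK _ hκ j)) (Ideal.mem_sup_right ?_)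
  clear hw
  induction hv using Submodule.closure_induction with
  | zero => simp
  | add a b _ _ ha hb => rw [map_add]; exact add_mem ha hb
  | smul_mem r g hg =>
    obtain ⟨i, hi, hgi⟩ := hg.2
    obtain ⟨t, rfl⟩ := Nat.exists_eq_add_of_le' (show i ≤ j by omega)
    rw [smul_eq_mul, homogeneousComponent_mul_of_homogeneous hgi]
    exact Ideal.mul_mem_mul (mem_idealOfVars_of_homogeneous (by omega)
      (homogeneousComponent_isHomogeneous t r)) (mem_truncated hg.1 hgi hi)

/-- Injectivity of multiplication by x in degree l propagates to all higher degrees once no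
generators beyond degree l + 1 are allowed. If xz lies in the truncation, then xz = xa + yb modulo K
with a, b in it; so b = wx modulo K, w lies in the truncation by induction, and z = a + yw modulo K.
-/
theorem IsPlane.gr_quot_truncated_le {K J : Ideal (MvPolynomial σ k)} {x y : MvPolynomial σ k}
    (hP : IsPlane K x y) {l : ℕ} (hKJ : K ≤ J) (hinj : gr (GradedIdeal.quot J x) l ≤ gr J l) :
    ∀ j, l ≤ j → gr (GradedIdeal.quot (truncated K J (l + 1)) x) j ≤
      gr (truncated K J (l + 1)) j := by
  intro j hj
  induction j, hj using Nat.le_induction with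
  | base =>
    rintro z ⟨hz, hzl⟩
    have h1 := hinj ⟨truncated_le hKJ _ hz, hzl⟩
    exact ⟨mem_truncated h1.1 hzl (Nat.le_succ l), hzl⟩
  | succ j hj ih =>
    rintro z ⟨hz, hzl⟩
    refine ⟨?_, hzl⟩
    set J' := truncated K J (l + 1) with hJ'
    have hJg : IsGraded J' := isGraded_truncated hP.graded J _
    have hKJ' : K ≤ J' := le_sup_left
    have hxz : (x * z).IsHomogeneous (j + 1 + 1) := by
      rw [add_comm]; exact hP.hom_x.mul hzl
    have h1 := homogeneousComponent_truncated_mem hP.graded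
      (show l + 1 < j + 1 + 1 by omega) (mem_quot.1 hz)
    rw [homogeneousComponent_self hxz] at h1
    have h2 : K ⊔ idealOfVars σ k * J' ≤ K ⊔ (Ideal.span {x} * J' ⊔ Ideal.span {y} * J') := by
      refine sup_le le_sup_left ((Ideal.mul_mono_left hP.vars_le).trans ?_)
      rw [Ideal.sup_mul, Ideal.sup_mul, sup_assoc]
      exact sup_le_sup_right Ideal.mul_le_left _
    obtain ⟨κ, hκ, v, hv, hκv⟩ := Submodule.mem_sup.1 (h2 h1)
    obtain ⟨a', ha', b', hb', hab⟩ := Submodule.mem_sup.1 hv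
    obtain ⟨a, ha, rfl⟩ := Ideal.mem_span_singleton_mul.1 ha'
    obtain ⟨b, hb, rfl⟩ := Ideal.mem_span_singleton_mul.1 hb'
    obtain ⟨w, hw⟩ := mem_sup_span.1 (hP.reg_y b (mem_sup_span.2 ⟨z - a, by
      have : y * b - (z - a) * x = -κ := by rw [← hab] at hκv; linear_combination hκv
      rw [this]; exact K.neg_mem hκ⟩))
    have hw' := hP.graded _ hw (j + 1)
    rw [map_sub, homogeneousComponent_mul_of_homogeneous hP.hom_x] at hw'
    have h3 : homogeneousComponent j w ∈ J' := by
      refine (ih ⟨?_, homogeneousComponent_isHomogeneous j w⟩).1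
      have := J'.sub_mem (hJg _ hb (j + 1)) (hKJ' hw')
      rwa [sub_sub_cancel, mul_comm] at this
    have h4 := congrArg (homogeneousComponent (j + 1 + 1)) hκv
    rw [← hab, map_add, map_add, homogeneousComponent_self hxz, mul_comm x a, mul_comm y b,
      homogeneousComponent_mul_of_homogeneous hP.hom_x,
      homogeneousComponent_mul_of_homogeneous hP.hom_y] at h4
    have h5 : z - homogeneousComponent (j + 1) a - y * homogeneousComponent j w ∈ K := by
      refine hP.reg_x _ ?_
      have : x * (z - homogeneousComponent (j + 1) a - y * homogeneousComponent j w) =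
          homogeneousComponent (j + 1 + 1) κ +
          y * (homogeneousComponent (j + 1) b - homogeneousComponent j w * x) := by
        linear_combination -h4
      rw [this]
      exact K.add_mem (hP.graded _ hκ _) (K.mul_mem_left _ hw')
    have := J'.add_mem (J'.add_mem (hKJ' h5) (J'.mul_mem_left y h3)) (hJg _ ha (j + 1))
    simpa using this

theorem DepthGE.of_succ {m : ℕ} : ∀ {I : Ideal (MvPolynomial σ k)}, DepthGE (m + 1) I →
    DepthGE m I := by
  induction m with
  | zero => intros; trivial
  | succ m ih => exact fun ⟨f, hf, hr, hd⟩ => ⟨f, hf, hr, ih hd⟩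

variable [Finite σ]

theorem hilb_succ_le {J : Ideal (MvPolynomial σ k)} (hJ : IsGraded J) {x : MvPolynomial σ k}
    (hx : x.IsHomogeneous 1) {l : ℕ} (h : hilb (J ⊔ Ideal.span {x}) (l + 1) = 0) :
    hilb J (l + 1) ≤ hilb J l := by
  rw [← hilb_sup_span_add hJ hx l, h, zero_add]
  exact hilb_anti (le_quot J x) l

/-- If the Hilbert function takes the same nonzero value in degrees `l` and `l + 1`, then the
elements of degree at most `l + 1` do not generate an ideal of finite colength. -/
theorem IsPlane.hilb_eq_zero_of_flat {K J : Ideal (MvPolynomial σ k)} {x y : MvPolynomial σ k}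
    (hP : IsPlane K x y) {l : ℕ} (hJ : IsGraded J) (hKJ : K ≤ J)
    (hx : hilb (J ⊔ Ideal.span {x}) (l + 1) = 0) (hflat : hilb J (l + 1) = hilb J l)
    {f g : MvPolynomial σ k} {a b j : ℕ} (hf : f ∈ J) (hfa : f.IsHomogeneous a) (ha : a ≤ l + 1)
    (hg : g ∈ J) (hgb : g.IsHomogeneous b) (hb : b ≤ l + 1) (hj : l ≤ j)
    (h0 : hilb (K ⊔ Ideal.span {f} ⊔ Ideal.span {g}) j = 0) : hilb J l = 0 := by
  have hinj : gr (GradedIdeal.quot J x) l ≤ gr J l := by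
    refine (gr_eq_of_hilb_eq (gr_mono (le_quot J x) l) ?_).ge
    have := hilb_sup_span_add hJ hP.hom_x l
    omega
  have h1 := hP.gr_quot_truncated_le hKJ hinj
  set J' := truncated K J (l + 1) with hJ'
  -- Injectivity of x makes the Hilbert function of the truncation nondecreasing from l on. It
  -- vanishes at j, hence at l.
  have hmono : ∀ i, l ≤ i → hilb J' l ≤ hilb J' i := by
    intro i hi
    induction i, hi using Nat.le_induction with
    | base => rfl
    | succ i hi ih =>
      refine ih.trans ?_
      rw [← hilb_sup_span_add (isGraded_truncated hP.graded J _) hP.hom_x i,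
        hilb_eq_of_gr_eq (le_antisymm (h1 i hi) (gr_mono (le_quot J' x) i))]
      exact Nat.le_add_left _ _
  have h2 : hilb J' j = 0 := by
    refine Nat.le_zero.1 ((hilb_anti (sup_le (sup_le le_sup_left ?_) ?_) j).trans h0.le)
    · rw [Ideal.span_singleton_le_iff_mem]; exact mem_truncated hf hfa ha
    · rw [Ideal.span_singleton_le_iff_mem]; exact mem_truncated hg hgb hb
  have h3 := hmono j hj
  have h4 : hilb J l ≤ hilb J' l := hilb_anti (truncated_le hKJ (l + 1)) l
  omega

/-- One section must serve several ideals at once. Those in T, in practice principal, have one more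
unit of depth, so x can also be taken regular on their sections. -/
theorem exists_isPlane [Infinite k] [Fintype σ] {m : ℕ} (hm : Fintype.card σ = m + 2)
    {S T : Set (Ideal (MvPolynomial σ k))} (hS : S.Finite) (hT : T.Finite)
    (hSg : ∀ I ∈ S, IsGraded I) (hTg : ∀ I ∈ T, IsGraded I) (hSd : ∀ I ∈ S, DepthGE m I)
    (hTd : ∀ I ∈ T, DepthGE (m + 1) I) :
    ∃ K x y, IsPlane K x y ∧ (∀ I ∈ S, IsLinearSection m K I) ∧
      ∀ I ∈ T, IsLinearSection m K I ∧ Reg (I ⊔ K) x := by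
  have hbot : DepthGE (m + 2) (⊥ : Ideal (MvPolynomial σ k)) := hm ▸ depthGE_bot
  obtain ⟨K, hK, hKs⟩ := exists_isLinearSection m (S := insert ⊥ (S ∪ T))
    ((hS.union hT).insert _) (by
      rintro I (rfl | hI | hI)
      exacts [isGraded_bot, hSg I hI, hTg I hI]) (by
      rintro I (rfl | hI | hI)
      exacts [hbot.of_succ.of_succ, hSd I hI, (hTd I hI).of_succ])
  have hKb := hKs ⊥ (Set.mem_insert _ _)
  have hK2 : DepthGE 2 K := by simpa using hKb.depth 2 hbot
  obtain ⟨x, hx, hxr⟩ := exists_linear_reg (S := insert K ((fun I => I ⊔ K) '' T))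
    ((hT.image _).insert _) (by
      rintro I (rfl | ⟨I, hI, rfl⟩)
      · exact hK2.noSocle
      · exact ((hKs I (by simp [hI])).depth 1 (hTd I hI)).noSocle)
  have hxK := hxr K (Set.mem_insert _ _)
  have hK1 : DepthGE 1 (K ⊔ Ideal.span {x}) := hK2.sup_span hxK
  obtain ⟨y, hy, hyr⟩ := exists_linear_reg (S := {K ⊔ Ideal.span {x}}) (by simp)
    (by rintro I rfl; exact hK1.noSocle)
  have hyK := hyr _ rfl
  have hKHS : (1 - PowerSeries.X) ^ 2 * HS K = 1 := by
    have h1 := hKb.HS_eq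
    rw [bot_sup_eq] at h1
    rw [h1, ← mul_assoc, ← pow_add, add_comm, ← hm, HS_bot]
  refine ⟨K, x, y, ⟨hK, hx, hy, hxK, hyK, ?_, hKHS⟩, fun I hI => hKs I (by simp [hI]),
    fun I hI => ⟨hKs I (by simp [hI]), hxr _ (Set.mem_insert_of_mem _ ⟨I, hI, rfl⟩)⟩⟩
  -- Series 1 means that nothing survives in degree 1, so every variable lies in K + (x, y).
  have h2 : HS (K ⊔ Ideal.span {x} ⊔ Ideal.span {y}) = 1 := by
    rw [hyK.HS_sup_span (hK.sup_span hx) hy, hxK.HS_sup_span hK hx]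
    linear_combination hKHS
  have h3 : hilb (K ⊔ Ideal.span {x} ⊔ Ideal.span {y}) 1 = 0 := by
    have := coeff_HS (K ⊔ Ideal.span {x} ⊔ Ideal.span {y}) 1
    rw [h2, PowerSeries.coeff_one] at this
    simpa using this.symm
  rw [idealOfVars, Ideal.span_le]
  rintro _ ⟨i, rfl⟩
  exact hilb_eq_zero_iff.1 h3 _ (isHomogeneous_X k i)

end GradedIdeal

/-! ### Series of complete intersections, and the constraints on the h-vector. -/

namespace GradedIdeal

variable {σ k : Type*} [Field k]

/-- The Hilbert series `1 / (1 - X) ^ 2` of a polynomial ring in two variables. -/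
noncomputable def planeSeries : PowerSeries ℤ := PowerSeries.mk fun l => ((l + 1 : ℕ) : ℤ)

theorem coeff_X_pow_mul_planeSeries (a l : ℕ) :
    PowerSeries.coeff l (PowerSeries.X ^ a * planeSeries) = ((l + 1 - a : ℕ) : ℤ) := by
  rw [PowerSeries.coeff_X_pow_mul', planeSeries, PowerSeries.coeff_mk]
  split_ifs with h
  · congr 1; omega
  · rw [Nat.sub_eq_zero_of_le (by omega), Nat.cast_zero]

theorem coeff_planeSeries (l : ℕ) : PowerSeries.coeff l planeSeries = ((l + 1 : ℕ) : ℤ) :=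
  PowerSeries.coeff_mk _ _

theorem one_sub_X_sq_mul_planeSeries : (1 - PowerSeries.X) ^ 2 * planeSeries = 1 := by
  have : (1 - PowerSeries.X) ^ 2 * planeSeries =
      PowerSeries.X ^ 0 * planeSeries - PowerSeries.X ^ 1 * planeSeries -
        PowerSeries.X ^ 1 * planeSeries + PowerSeries.X ^ 2 * planeSeries := by
    ring
  rw [this]
  ext l
  simp only [map_add, map_sub, coeff_X_pow_mul_planeSeries, PowerSeries.coeff_one]
  split_ifs <;> push_cast <;> omega

theorem one_sub_X_ne_zero : (1 - PowerSeries.X : PowerSeries ℤ) ≠ 0 := by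
  intro h
  have := congrArg (PowerSeries.coeff 0) h
  simp at this

theorem IsPlane.HS_eq_planeSeries {K : Ideal (MvPolynomial σ k)} {x y : MvPolynomial σ k}
    (hP : IsPlane K x y) : HS K = planeSeries :=
  mul_left_cancel₀ (pow_ne_zero 2 one_sub_X_ne_zero)
    (hP.HS_eq.trans one_sub_X_sq_mul_planeSeries.symm)

theorem IsPlane.hilb_eq {K : Ideal (MvPolynomial σ k)} {x y : MvPolynomial σ k}
    (hP : IsPlane K x y) (l : ℕ) : hilb K l = l + 1 := by
  have := coeff_HS K l
  rw [hP.HS_eq_planeSeries, coeff_planeSeries] at this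
  exact_mod_cast this.symm

theorem hilb_eq_of_HS {I : Ideal (MvPolynomial σ k)} {P : PowerSeries ℤ} {l a : ℕ} (h : HS I = P)
    (hP : PowerSeries.coeff l P = (a : ℤ)) : hilb I l = a := by
  have := coeff_HS I l
  rw [h, hP] at this
  exact_mod_cast this.symm

theorem span_pair_eq_sup {R : Type*} [CommRing R] (f g : R) :
    Ideal.span {f, g} = Ideal.span {f} ⊔ Ideal.span {g} := Ideal.span_insert f {g}

theorem reg_bot {f : MvPolynomial σ k} (hf : f ≠ 0) :
    Reg (⊥ : Ideal (MvPolynomial σ k)) f := by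
  intro z hz
  rw [Ideal.mem_bot] at *
  exact (mul_eq_zero.1 hz).resolve_left hf

theorem reg_span_of_prime {R : Type*} [CommRing R] {f g : R} (hf : Prime f) (hg : ¬ f ∣ g) :
    Reg (Ideal.span {f}) g := by
  intro z hz
  rw [Ideal.mem_span_singleton] at *
  exact (hf.dvd_or_dvd hz).resolve_left hg

theorem isGraded_span_pair {f g : MvPolynomial σ k} {a b : ℕ} (hfa : f.IsHomogeneous a)
    (hgb : g.IsHomogeneous b) : IsGraded (Ideal.span {f, g}) := by
  rw [span_pair_eq_sup]
  exact (isGraded_span_singleton hfa).sup_span hgb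

section

variable [Finite σ]

theorem HS_span_singleton {f : MvPolynomial σ k} {a : ℕ} (hfa : f.IsHomogeneous a)
    (hf : Reg (⊥ : Ideal (MvPolynomial σ k)) f) :
    HS (Ideal.span {f}) = (1 - PowerSeries.X ^ a) * HS (⊥ : Ideal (MvPolynomial σ k)) := by
  simpa using hf.HS_sup_span isGraded_bot hfa

theorem HS_span_pair {f g : MvPolynomial σ k} {a b : ℕ} (hfa : f.IsHomogeneous a)
    (hgb : g.IsHomogeneous b) (hf : Reg (⊥ : Ideal (MvPolynomial σ k)) f)
    (hg : Reg (Ideal.span {f}) g) : HS (Ideal.span {f, g}) =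
      (1 - PowerSeries.X ^ a) * (1 - PowerSeries.X ^ b) * HS (⊥ : Ideal (MvPolynomial σ k)) := by
  rw [span_pair_eq_sup, hg.HS_sup_span (isGraded_span_singleton hfa) hgb,
    HS_span_singleton hfa hf]
  ring

end

variable [Fintype σ]

theorem one_sub_X_pow_mul_HS_bot {m : ℕ} (hm : Fintype.card σ = m + 2) :
    (1 - PowerSeries.X) ^ m * HS (⊥ : Ideal (MvPolynomial σ k)) = planeSeries := by
  refine mul_left_cancel₀ (pow_ne_zero 2 one_sub_X_ne_zero) ?_
  rw [one_sub_X_sq_mul_planeSeries, ← mul_assoc, ← pow_add, add_comm, ← hm, HS_bot]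

theorem depthGE_span_singleton [Infinite k] {m : ℕ} (hm : Fintype.card σ = m + 2)
    {f : MvPolynomial σ k} (hf : Reg (⊥ : Ideal (MvPolynomial σ k)) f) :
    DepthGE (m + 1) (Ideal.span {f}) := by
  simpa using DepthGE.sup_span (hm ▸ depthGE_bot) hf

theorem depthGE_span_pair [Infinite k] {m : ℕ} (hm : Fintype.card σ = m + 2)
    {f g : MvPolynomial σ k} (hf : Reg (⊥ : Ideal (MvPolynomial σ k)) f)
    (hg : Reg (Ideal.span {f}) g) : DepthGE m (Ideal.span {f, g}) := by
  rw [span_pair_eq_sup]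
  exact (depthGE_span_singleton hm hf).sup_span hg

theorem IsLinearSection.HS_span_singleton {m : ℕ} (hm : Fintype.card σ = m + 2)
    {K : Ideal (MvPolynomial σ k)} {f : MvPolynomial σ k} {a : ℕ} (hfa : f.IsHomogeneous a)
    (hf : Reg (⊥ : Ideal (MvPolynomial σ k)) f) (h : IsLinearSection m K (Ideal.span {f})) :
    HS (Ideal.span {f} ⊔ K) = (1 - PowerSeries.X ^ a) * planeSeries := by
  rw [h.HS_eq, GradedIdeal.HS_span_singleton hfa hf, ← one_sub_X_pow_mul_HS_bot (k := k) hm]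
  ring

theorem IsLinearSection.HS_span_pair {m : ℕ} (hm : Fintype.card σ = m + 2)
    {K : Ideal (MvPolynomial σ k)} {f g : MvPolynomial σ k} {a b : ℕ} (hfa : f.IsHomogeneous a)
    (hgb : g.IsHomogeneous b) (hf : Reg (⊥ : Ideal (MvPolynomial σ k)) f)
    (hg : Reg (Ideal.span {f}) g) (h : IsLinearSection m K (Ideal.span {f, g})) :
    HS (Ideal.span {f, g} ⊔ K) =
      (1 - PowerSeries.X ^ a) * (1 - PowerSeries.X ^ b) * planeSeries := by
  rw [h.HS_eq, GradedIdeal.HS_span_pair hfa hgb hf hg, ← one_sub_X_pow_mul_HS_bot (k := k) hm]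
  ring

theorem IsLinearSection.hilb_span_singleton {m : ℕ} (hm : Fintype.card σ = m + 2)
    {K : Ideal (MvPolynomial σ k)} {f : MvPolynomial σ k} {a : ℕ} (hfa : f.IsHomogeneous a)
    (hf : Reg (⊥ : Ideal (MvPolynomial σ k)) f) (h : IsLinearSection m K (Ideal.span {f}))
    (l : ℕ) : hilb (Ideal.span {f} ⊔ K) l = (l + 1) - (l + 1 - a) := by
  refine hilb_eq_of_HS (h.HS_span_singleton hm hfa hf) ?_
  rw [sub_mul, one_mul, map_sub, coeff_planeSeries, coeff_X_pow_mul_planeSeries]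
  omega

theorem IsLinearSection.hilb_span_pair {m : ℕ} (hm : Fintype.card σ = m + 2)
    {K : Ideal (MvPolynomial σ k)} {f g : MvPolynomial σ k} {a b : ℕ} (hfa : f.IsHomogeneous a)
    (hgb : g.IsHomogeneous b) (hf : Reg (⊥ : Ideal (MvPolynomial σ k)) f)
    (hg : Reg (Ideal.span {f}) g) (h : IsLinearSection m K (Ideal.span {f, g})) (l : ℕ) :
    (hilb (Ideal.span {f, g} ⊔ K) l : ℤ) =
      ((l + 1 : ℕ) : ℤ) - (l + 1 - a : ℕ) - (l + 1 - b : ℕ) + (l + 1 - (a + b) : ℕ) := by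
  rw [← coeff_HS, h.HS_span_pair hm hfa hgb hf hg]
  have : (1 - PowerSeries.X ^ a) * (1 - PowerSeries.X ^ b) * planeSeries =
      planeSeries - PowerSeries.X ^ a * planeSeries - PowerSeries.X ^ b * planeSeries +
        PowerSeries.X ^ (a + b) * planeSeries := by ring
  rw [this]
  simp only [map_add, map_sub, coeff_planeSeries, coeff_X_pow_mul_planeSeries]

theorem IsLinearSection.hilb_sup_x {m : ℕ} (hm : Fintype.card σ = m + 2)
    {K : Ideal (MvPolynomial σ k)} {f x : MvPolynomial σ k} {a : ℕ} (hK : IsGraded K)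
    (hx : x.IsHomogeneous 1) (hfa : f.IsHomogeneous a)
    (hf : Reg (⊥ : Ideal (MvPolynomial σ k)) f) (h : IsLinearSection m K (Ideal.span {f}))
    (hr : Reg (Ideal.span {f} ⊔ K) x) {l : ℕ} (hl : a ≤ l) :
    hilb (Ideal.span {f} ⊔ K ⊔ Ideal.span {x}) l = 0 := by
  refine hilb_eq_of_HS ((hr.HS_sup_span ((isGraded_span_singleton hfa).sup hK) hx).trans
    (congrArg _ (h.HS_span_singleton hm hfa hf))) ?_
  have : (1 - PowerSeries.X ^ 1) * ((1 - PowerSeries.X ^ a) * planeSeries) =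
      planeSeries - PowerSeries.X ^ a * planeSeries - PowerSeries.X ^ 1 * planeSeries +
        PowerSeries.X ^ (a + 1) * planeSeries := by ring
  rw [this]
  simp only [map_add, map_sub, coeff_planeSeries, coeff_X_pow_mul_planeSeries]
  push_cast
  omega

/-- The constraints on the `h`-vector of a codimension two ACM subscheme contained in an
integral hypersurface of degree `d`. -/
structure IsAdmissible (d : ℕ) (h : ℕ → ℕ) : Prop where
  le_degree : ∀ l, h l ≤ d
  exists_initial : ∃ e ≤ d, (∀ l < e, h l = l + 1) ∧ ∀ l, e ≤ l + 1 → h (l + 1) ≤ h l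
  flat : ∀ l, d ≤ l + 1 → h (l + 1) = h l → h l = 0 ∨ h l = d

theorem isAdmissible_of_depthGE [Infinite k] {m d : ℕ} (hm : Fintype.card σ = m + 2)
    {I : Ideal (MvPolynomial σ k)} (hI : IsGraded I) (hId : DepthGE m I) {F : MvPolynomial σ k}
    (hF : Irreducible F) (hFd : F.IsHomogeneous d) (hFI : F ∈ I) {h : ℕ → ℕ}
    (hh : ∀ l, (h l : ℤ) = PowerSeries.coeff l ((1 - PowerSeries.X) ^ m * HS I)) :
    IsAdmissible d h := by
  classical
  -- Since h is the same for every section, K may be chosen anew below, adapted to a form G.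
  have hsec : ∀ K, IsLinearSection m K I → ∀ l, hilb (I ⊔ K) l = h l := fun K hK l =>
    hilb_eq_of_HS hK.HS_eq (hh l).symm
  have hF0 : Reg (⊥ : Ideal (MvPolynomial σ k)) F := reg_bot hF.ne_zero
  have hex : ∃ e, ∃ f ∈ I, f.IsHomogeneous e ∧ f ≠ 0 := ⟨d, F, hFI, hFd, hF.ne_zero⟩
  obtain ⟨f, hfI, hfe, hf0⟩ := Nat.find_spec hex
  have hfr : Reg (⊥ : Ideal (MvPolynomial σ k)) f := reg_bot hf0
  set e := Nat.find hex with he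
  obtain ⟨K, x, y, hP, hKS, hKT⟩ := exists_isPlane hm (S := {I})
    (T := {Ideal.span {F}, Ideal.span {f}}) (by simp) (by simp) (by simpa using hI)
    (by
      rintro J (rfl | rfl)
      exacts [isGraded_span_singleton hFd, isGraded_span_singleton hfe])
    (by simpa using hId)
    (by
      rintro J (rfl | rfl)
      exacts [depthGE_span_singleton hm hF0, depthGE_span_singleton hm hfr])
  have hIK := hKS I rfl
  refine ⟨fun l => ?_, ⟨e, Nat.find_min' hex ⟨F, hFI, hFd, hF.ne_zero⟩, fun l hl => ?_,
    fun l hl => ?_⟩, fun l hl hflat => ?_⟩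
  · rw [← hsec K hIK]
    refine (hilb_anti (sup_le_sup_right ((Ideal.span_singleton_le_iff_mem _).2 hFI) K) l).trans ?_
    rw [(hKT _ (by simp)).1.hilb_span_singleton hm hFd hF0]
    omega
  · rw [← hsec K hIK, ← hP.hilb_eq l]
    refine (hilb_eq_of_gr_eq (le_antisymm (gr_mono le_sup_right l) ?_)).symm
    rintro z ⟨hz, hzl⟩
    obtain ⟨i, hi, κ, hκ, rfl⟩ := Submodule.mem_sup.1 hz
    have h1 : homogeneousComponent l i = 0 := by
      by_contra hne
      exact Nat.find_min hex hl ⟨_, hI _ hi l, homogeneousComponent_isHomogeneous l i, hne⟩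
    have h2 := homogeneousComponent_self hzl
    rw [map_add, h1, zero_add] at h2
    exact ⟨h2 ▸ hP.graded _ hκ l, hzl⟩
  · rw [← hsec K hIK, ← hsec K hIK]
    obtain ⟨h1, h2⟩ := hKT (Ideal.span {f}) (by simp)
    refine hilb_succ_le (hI.sup hP.graded) hP.hom_x (Nat.le_zero.1 ?_)
    rw [← h1.hilb_sup_x hm hP.graded hP.hom_x hfe hfr h2 hl]
    exact hilb_anti (sup_le_sup_right (sup_le_sup_right
      ((Ideal.span_singleton_le_iff_mem _).2 hfI) K) _) _
  -- Irreducibility is used upstairs, before cutting, since F may factor in the plane. If all forms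
  -- of degree at most l + 1 are multiples of F, then h(l + 1) is the value d of the section of F;
  -- otherwise F, G is regular and forces h(l) = 0.
  by_cases hG : ∃ b ≤ l + 1, ∃ G ∈ I, G.IsHomogeneous b ∧ ¬ F ∣ G
  · left
    obtain ⟨b, hb, G, hGI, hGb, hFG⟩ := hG
    have hGr := reg_span_of_prime hF.prime hFG
    obtain ⟨K, x, y, hP, hKS, hKT⟩ := exists_isPlane hm (S := {I, Ideal.span {F, G}})
      (T := {Ideal.span {F}}) (by simp) (by simp)
      (by
        rintro J (rfl | rfl)
        exacts [hI, isGraded_span_pair hFd hGb])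
      (by simpa using isGraded_span_singleton hFd)
      (by
        rintro J (rfl | rfl)
        exacts [hId, depthGE_span_pair hm hF0 hGr])
      (by simpa using depthGE_span_singleton hm hF0)
    have hIK := hKS I (by simp)
    obtain ⟨h1, h2⟩ := hKT (Ideal.span {F}) rfl
    rw [← hsec K hIK, ← hsec K hIK] at hflat
    rw [← hsec K hIK]
    -- Any degree that is at least l and at least d + b - 1, where the complete intersection (d, b)
    -- in the plane vanishes, would do for j.
    refine hP.hilb_eq_zero_of_flat (hI.sup hP.graded) le_sup_right (Nat.le_zero.1 ?_) hflat
      (Ideal.mem_sup_left hFI) hFd hl (Ideal.mem_sup_left hGI) hGb hb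
      (j := l + d + b) (by omega) ?_
    · rw [← h1.hilb_sup_x hm hP.graded hP.hom_x hFd hF0 h2 hl]
      exact hilb_anti (sup_le_sup_right (sup_le_sup_right
        ((Ideal.span_singleton_le_iff_mem _).2 hFI) K) _) _
    · have := (hKS (Ideal.span {F, G}) (by simp)).hilb_span_pair hm hFd hGb hF0 hGr (l + d + b)
      rw [sup_assoc, sup_comm, ← span_pair_eq_sup]
      omega
  · right
    push Not at hG
    have h1 : ∀ i ≤ l + 1, gr I i = gr (Ideal.span {F}) i := by
      intro i hi
      refine le_antisymm (fun z hz => ?_)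
        (gr_mono ((Ideal.span_singleton_le_iff_mem _).2 hFI) i)
      exact ⟨Ideal.mem_span_singleton.2 (hG i hi z hz.1 hz.2), hz.2⟩
    have h2 : h (l + 1) = hilb (Ideal.span {F} ⊔ K) (l + 1) := by
      rw [← hsec K hIK]
      refine hilb_eq_of_gr_eq (le_antisymm ?_
        (gr_mono (sup_le_sup_right ((Ideal.span_singleton_le_iff_mem _).2 hFI) K) _))
      rintro z ⟨hz, hzl⟩
      obtain ⟨i, hi, κ, hκ, rfl⟩ := Submodule.mem_sup.1 hz
      have h3 := homogeneousComponent_self hzl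
      have h4 : homogeneousComponent (l + 1) i ∈ gr (Ideal.span {F}) (l + 1) :=
        h1 _ le_rfl ▸ ⟨hI _ hi _, homogeneousComponent_isHomogeneous _ i⟩
      rw [map_add] at h3
      exact ⟨h3 ▸ Submodule.add_mem_sup h4.1 (hP.graded _ hκ _), hzl⟩
    rw [← hflat, h2, (hKT _ (by simp)).1.hilb_span_singleton hm hFd hF0]
    omega

end GradedIdeal

/-! ### Numerical comparison of h-vectors. -/

namespace GradedIdeal

/-- The `h`-vector of the residual of a complete intersection of type `(1, r)` in a complete
intersection of type `(s, d)`. -/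
def linkedH (s d r l : ℕ) : ℤ :=
  ((l + 1 : ℕ) : ℤ) - (l + 1 - s : ℕ) - (l + 1 - d : ℕ) + (l + 1 - (s + d) : ℕ) -
    if s + d - 1 - r ≤ l ∧ l < s + d - 1 then 1 else 0

theorem two_mul_sum_sub (a : ℕ) {N : ℕ} (h : a ≤ N) :
    2 * ∑ i ∈ Finset.range N, ((i + 1 - a : ℕ) : ℤ) = (N - a) * (N - a + 1) := by
  induction N, h using Nat.le_induction with
  | base =>
    rw [Finset.sum_eq_zero]
    · ring
    · intro i hi
      rw [Finset.mem_range] at hi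
      rw [Nat.sub_eq_zero_of_le (by omega), Nat.cast_zero]
  | succ N h ih =>
    rw [Finset.sum_range_succ, mul_add, ih, Nat.cast_sub (by omega)]
    push_cast
    ring

theorem sum_Ico_indicator {a b N : ℕ} (hab : a ≤ b) (hN : b ≤ N) :
    ∑ i ∈ Finset.range N, (if a ≤ i ∧ i < b then (1 : ℤ) else 0) = b - a := by
  rw [Finset.sum_ite, Finset.sum_const_zero, add_zero, Finset.sum_const, nsmul_eq_mul, mul_one]
  have : (Finset.range N).filter (fun i => a ≤ i ∧ i < b) = Finset.Ico a b := by
    ext i; simp only [Finset.mem_filter, Finset.mem_range, Finset.mem_Ico]; omega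
  rw [this, Nat.card_Ico]
  omega

theorem sum_linkedH {s d r N : ℕ} (hr : r < d) (hN : s + d ≤ N) :
    ∑ i ∈ Finset.range N, linkedH s d r i = s * d - r := by
  have h0 := two_mul_sum_sub 0 (Nat.zero_le N)
  have h1 := two_mul_sum_sub s (show s ≤ N by omega)
  have h2 := two_mul_sum_sub d (show d ≤ N by omega)
  have h3 := two_mul_sum_sub (s + d) hN
  have h4 := sum_Ico_indicator (a := s + d - 1 - r) (b := s + d - 1) (N := N)
    (by omega) (by omega)
  simp only [linkedH, Finset.sum_sub_distrib, Finset.sum_add_distrib, h4]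
  simp only [Nat.sub_zero] at h0
  have h5 : ((s + d - 1 : ℕ) : ℤ) - (s + d - 1 - r : ℕ) = r := by omega
  rw [h5]
  push_cast at *
  rw [sub_left_inj]
  refine mul_left_cancel₀ (two_ne_zero (α := ℤ)) ?_
  linear_combination h0 - h1 - h2 + h3

/-- An admissible `h`-vector that has dropped below `linkedH` stays below it. -/
theorem IsAdmissible.le_linkedH {s d r : ℕ} {h : ℕ → ℕ} (hh : IsAdmissible d h) (hr : r < d)
    {a : ℕ} (ha : (h a : ℤ) < linkedH s d r a) :
    ∀ l, a ≤ l → (h l : ℤ) ≤ linkedH s d r l := by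
  obtain ⟨e, he, hinit, hmono⟩ := hh.exists_initial
  have hea : e ≤ a := by
    by_contra hc
    rw [hinit a (by omega)] at ha
    unfold linkedH at ha
    split_ifs at ha <;> omega
  -- The induction needs strictness up to degree s + d - 1 - r, where `linkedH` loses an extra unit
  -- that h need not lose. From degree max(s, d) - 1 on, the complete intersection drops by 1 per
  -- step until it is 0, and the flatness constraint makes h drop too.
  suffices H : ∀ l, a ≤ l → (h l : ℤ) ≤ linkedH s d r l ∧
      (l < s + d - 1 - r → (h l : ℤ) < linkedH s d r l) from fun l hl => (H l hl).1
  intro l hl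
  induction l, hl using Nat.le_induction with
  | base => exact ⟨ha.le, fun _ => ha⟩
  | succ l hl ih =>
    have h1 := hmono l (by omega)
    have h2 := hh.flat l
    have h3 := hh.le_degree l
    unfold linkedH at *
    split_ifs at * <;> omega

/-- Among the admissible `h`-vectors of given total, `linkedH` has the smallest partial sums. -/
theorem IsAdmissible.sum_linkedH_le {s d r : ℕ} {h : ℕ → ℕ} (hh : IsAdmissible d h) (hr : r < d)
    {N : ℕ} (hN : ∀ M, N ≤ M →
      ∑ i ∈ Finset.range M, (h i : ℤ) = s * d - r) (L : ℕ) :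
    ∑ i ∈ Finset.range L, linkedH s d r i ≤ ∑ i ∈ Finset.range L, (h i : ℤ) := by
  by_cases hex : ∃ a, (h a : ℤ) < linkedH s d r a
  · classical
    rcases le_or_gt L (Nat.find hex) with hL | hL
    · refine Finset.sum_le_sum fun i hi => not_lt.1 fun hlt => ?_
      exact Nat.find_min hex (lt_of_lt_of_le (Finset.mem_range.1 hi) hL) hlt
    · have htail := hh.le_linkedH hr (Nat.find_spec hex)
      set M := N + (s + d) + L with hM
      have h1 := sum_linkedH (s := s) (N := M) hr (by omega)
      rw [← hN M (by omega), ← Finset.sum_range_add_sum_Ico _ (show L ≤ M by omega),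
        ← Finset.sum_range_add_sum_Ico _ (show L ≤ M by omega)] at h1
      -- Past the first crossing the tails compare the other way; equal totals convert this into the
      -- inequality of partial sums.
      have h2 : ∑ i ∈ Finset.Ico L M, (h i : ℤ) ≤ ∑ i ∈ Finset.Ico L M, linkedH s d r i :=
        Finset.sum_le_sum fun i hi => htail i (by rw [Finset.mem_Ico] at hi; omega)
      omega
  · push Not at hex
    exact Finset.sum_le_sum fun i _ => hex i

/-- With c = s + d - 1 - r, the product X^c (1 - X)(1 - X^r)/(1 - X)^2 is X^c + ... + X^(c+r-1), the
indicator subtracted in `linkedH`. As r < d, no natural subtraction truncates. -/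
theorem coeff_linkedH {s d r : ℕ} (hr : r < d) (l : ℕ) :
    PowerSeries.coeff l (((1 - PowerSeries.X ^ s) * (1 - PowerSeries.X ^ d) -
      PowerSeries.X ^ (s + d - 1 - r) * (1 - PowerSeries.X) * (1 - PowerSeries.X ^ r)) *
        planeSeries) = linkedH s d r l := by
  have : ((1 - PowerSeries.X ^ s) * (1 - PowerSeries.X ^ d) -
      PowerSeries.X ^ (s + d - 1 - r) * (1 - PowerSeries.X) * (1 - PowerSeries.X ^ r)) *
        planeSeries = planeSeries - PowerSeries.X ^ s * planeSeries - PowerSeries.X ^ d * planeSeries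
      + PowerSeries.X ^ (s + d) * planeSeries - (PowerSeries.X ^ (s + d - 1 - r) * planeSeries -
        PowerSeries.X ^ (s + d - 1 - r + 1) * planeSeries -
        PowerSeries.X ^ (s + d - 1 - r + r) * planeSeries +
        PowerSeries.X ^ (s + d - 1 - r + r + 1) * planeSeries) := by ring
  rw [this]
  simp only [map_add, map_sub, coeff_planeSeries, coeff_X_pow_mul_planeSeries, linkedH]
  split_ifs <;> omega

end GradedIdeal

namespace GradedIdeal

/-! ### Linkage by a complete intersection -/

/-- The residual of (h, g) in (f₁, f₂) is generated by (f₁, f₂) and the determinant of the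
transition matrix. Comparing the expressions of fh and fg through the Koszul relation of f₁, f₂
produces w, and the relation of h, g then gives the remaining coefficients. -/
theorem exists_sub_mem_of_linked {R : Type*} [CommRing R] {h g f₁ f₂ a b c e f : R}
    (hf₁ : f₁ = a * h + b * g) (hf₂ : f₂ = c * h + e * g) (hh : ∀ z, h * z = 0 → z = 0)
    (hg : Reg (Ideal.span {h}) g) (hr₁ : ∀ z, f₁ * z = 0 → z = 0) (hr₂ : Reg (Ideal.span {f₁}) f₂)
    (h1 : f * h ∈ Ideal.span {f₁, f₂}) (h2 : f * g ∈ Ideal.span {f₁, f₂}) :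
    ∃ w, f - w * (a * e - b * c) ∈ Ideal.span {f₁, f₂} := by
  obtain ⟨p, q, hpq⟩ := Ideal.mem_span_pair.1 h1
  obtain ⟨p', q', hpq'⟩ := Ideal.mem_span_pair.1 h2
  obtain ⟨w, hw⟩ := Ideal.mem_span_singleton'.1 (hr₂ (h * q' - g * q)
    (Ideal.mem_span_singleton'.2 ⟨g * p - h * p', by linear_combination g * hpq - h * hpq'⟩))
  have hw2 : g * p - h * p' - w * f₂ = 0 := hr₁ _ (by
    linear_combination g * hpq - h * hpq' - f₂ * hw)
  obtain ⟨p₂, hp₂⟩ := Ideal.mem_span_singleton'.1 (hg (p - w * e)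
    (Ideal.mem_span_singleton'.2 ⟨p' + w * c, by linear_combination -hw2 - w * hf₂⟩))
  obtain ⟨q₂, hq₂⟩ := Ideal.mem_span_singleton'.1 (hg (q + w * b)
    (Ideal.mem_span_singleton'.2 ⟨q' - w * a, by linear_combination -hw + w * hf₁⟩))
  refine ⟨w, Ideal.mem_span_pair.2 ⟨p₂, q₂, ?_⟩⟩
  rw [← sub_eq_zero]
  refine hh _ ?_
  linear_combination f₁ * hp₂ + f₂ * hq₂ + hpq - w * e * hf₁ + w * b * hf₂

theorem mul_det_mem {R : Type*} [CommRing R] {h g f₁ f₂ a b c e : R}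
    (hf₁ : f₁ = a * h + b * g) (hf₂ : f₂ = c * h + e * g) {z : R} (hz : z ∈ Ideal.span {h, g}) :
    (a * e - b * c) * z ∈ Ideal.span {f₁, f₂} := by
  obtain ⟨x, y, rfl⟩ := Ideal.mem_span_pair.1 hz
  refine Ideal.mem_span_pair.2 ⟨x * e - y * c, y * a - x * b, ?_⟩
  rw [hf₁, hf₂]
  ring

/-- Multiply by h and use Cramer's identity h · det = e f₁ - b f₂: regularity gives fb + hq = w f₁
and fe - hp = w f₂. Modulo the prime h, both e and b then kill f - wg. -/
theorem mem_of_mul_det_mem {R : Type*} [CommRing R] [IsDomain R] {h g f₁ f₂ a b c e f : R}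
    (hf₁ : f₁ = a * h + b * g) (hf₂ : f₂ = c * h + e * g) (hh : Prime h)
    (hr₁ : f₁ ≠ 0) (hr₂ : Reg (Ideal.span {f₁}) f₂)
    (hf : (a * e - b * c) * f ∈ Ideal.span {f₁, f₂}) : f ∈ Ideal.span {h, g} := by
  obtain ⟨p, q, hpq⟩ := Ideal.mem_span_pair.1 hf
  obtain ⟨w, hw⟩ := Ideal.mem_span_singleton'.1 (hr₂ (f * b + h * q)
    (Ideal.mem_span_singleton'.2 ⟨f * e - h * p, by
      linear_combination -h * hpq + f * e * hf₁ - f * b * hf₂⟩))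
  have hw2 : f * e - h * p = w * f₂ := mul_left_cancel₀ hr₁ (by
    linear_combination -h * hpq + f * e * hf₁ - f * b * hf₂ - f₂ * hw)
  have he : h ∣ e * (f - w * g) := ⟨p + w * c, by linear_combination hw2 + w * hf₂⟩
  have hb : h ∣ b * (f - w * g) := ⟨w * a - q, by linear_combination -hw + w * hf₁⟩
  by_cases hd : h ∣ f - w * g
  · obtain ⟨t, ht⟩ := hd
    exact Ideal.mem_span_pair.2 ⟨t, w, by linear_combination -ht⟩
  exfalso
  obtain ⟨e', rfl⟩ := (hh.dvd_or_dvd he).resolve_right hd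
  obtain ⟨b', rfl⟩ := (hh.dvd_or_dvd hb).resolve_right hd
  -- If h divided b and e, it would be a common factor of f₁ and f₂, and regularity would make it a
  -- unit.
  obtain ⟨t, ht⟩ := Ideal.mem_span_singleton'.1 (hr₂ (a + b' * g)
    (Ideal.mem_span_singleton'.2 ⟨c + e' * g, by rw [hf₁, hf₂]; ring⟩))
  have ha : f₁ = h * (a + b' * g) := by rw [hf₁]; ring
  have h0 : a + b' * g ≠ 0 := fun h0 => hr₁ (by rw [ha, h0, mul_zero])
  have : 1 = h * t := mul_left_cancel₀ h0 (by linear_combination -ht + t * ha)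
  exact hh.not_isUnit (isUnit_iff_dvd_one.2 ⟨t, this⟩)

variable {σ k : Type*} [Field k]

theorem prime_of_linear {h : MvPolynomial σ k} (h0 : h ≠ 0) (h1 : h.IsHomogeneous 1) :
    Prime h := by
  refine (irreducible_of_totalDegree_eq_one (h1.totalDegree h0) fun x hx => ?_).prime
  rw [isUnit_iff_ne_zero]
  rintro rfl
  refine h0 (MvPolynomial.ext _ _ fun i => ?_)
  simpa using hx i

theorem exists_homogeneous_combination {h g z : MvPolynomial σ k} {r s : ℕ}
    (hh : h.IsHomogeneous 1) (hg : g.IsHomogeneous r) (hs : 0 < s) (hz : z.IsHomogeneous s)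
    (hmem : z ∈ Ideal.span {h, g}) :
    ∃ a b, z = a * h + b * g ∧ a.IsHomogeneous (s - 1) ∧
      (b = 0 ∨ r ≤ s ∧ b.IsHomogeneous (s - r)) := by
  obtain ⟨t, rfl⟩ := Nat.exists_eq_add_of_le' hs
  rw [span_pair_eq_sup] at hmem
  have key : ∀ z : MvPolynomial σ k, z.IsHomogeneous (t + 1) → z ∈ Ideal.span {h} →
      ∃ a, a.IsHomogeneous t ∧ z = a * h := by
    intro z hz hzh
    obtain ⟨a, ha, haz⟩ := (isGraded_bot.mem_sup_span_iff hh hz).1 (Ideal.mem_sup_right hzh)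
    exact ⟨a, ha, sub_eq_zero.1 (by simpa using haz)⟩
  rcases lt_or_ge (t + 1) r with hr | hr
  · obtain ⟨a, ha, rfl⟩ := key z hz
      ((isGraded_span_singleton hh).mem_of_mem_sup_span_of_lt hg hz hr hmem)
    exact ⟨a, 0, by ring, ha, Or.inl rfl⟩
  · obtain ⟨v, hv⟩ := Nat.exists_eq_add_of_le' hr
    obtain ⟨b, hb, hbz⟩ := ((isGraded_span_singleton hh).mem_sup_span_iff hg (hv ▸ hz)).1 hmem
    obtain ⟨a, ha, haz⟩ := key _ (hz.sub (by rw [hv]; exact hb.mul hg)) hbz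
    refine ⟨a, b, by rw [← haz]; ring, ha, Or.inr ⟨hr, ?_⟩⟩
    rwa [hv, Nat.add_sub_cancel]

theorem isHomogeneous_det {a b c e : MvPolynomial σ k} {r s d : ℕ} (hs : 0 < s)
    (hr : r < d) (ha : a.IsHomogeneous (s - 1)) (hb : b = 0 ∨ r ≤ s ∧ b.IsHomogeneous (s - r))
    (hc : c.IsHomogeneous (d - 1)) (he : e = 0 ∨ r ≤ d ∧ e.IsHomogeneous (d - r)) :
    (a * e - b * c).IsHomogeneous (s + d - 1 - r) := by
  refine IsHomogeneous.sub ?_ ?_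
  · rcases he with rfl | ⟨-, he⟩
    · rw [mul_zero]; exact isHomogeneous_zero _ _ _
    · have := ha.mul he
      rwa [show s - 1 + (d - r) = s + d - 1 - r by omega] at this
  · rcases hb with rfl | ⟨hrs, hb⟩
    · rw [zero_mul]; exact isHomogeneous_zero _ _ _
    · have := hb.mul hc
      rwa [show s - r + (d - 1) = s + d - 1 - r by omega] at this

variable [Finite σ]

/-- The Hilbert series of the residual of a complete intersection of type `(1, r)` in a complete
intersection of type `(s, d)`. -/
theorem HS_of_linked {h g f₁ f₂ : MvPolynomial σ k} {r s d : ℕ} (hs : s = 0 → r = 0) (hr : r < d)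
    (hh1 : h.IsHomogeneous 1) (hgr : g.IsHomogeneous r) (hh : Reg ⊥ h)
    (hg : Reg (Ideal.span {h}) g) (hf₁s : f₁.IsHomogeneous s) (hf₂d : f₂.IsHomogeneous d)
    (hf₁ : Reg ⊥ f₁) (hf₂ : Reg (Ideal.span {f₁}) f₂)
    (hle : Ideal.span {f₁, f₂} ≤ Ideal.span {h, g}) {J : Ideal (MvPolynomial σ k)}
    (hJ : ∀ f, f ∈ J ↔ ∀ z ∈ Ideal.span {h, g}, f * z ∈ Ideal.span {f₁, f₂}) :
    HS J = ((1 - PowerSeries.X ^ s) * (1 - PowerSeries.X ^ d) -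
      PowerSeries.X ^ (s + d - 1 - r) * (1 - PowerSeries.X) * (1 - PowerSeries.X ^ r)) *
        HS (⊥ : Ideal (MvPolynomial σ k)) := by
  have hne : ∀ {f : MvPolynomial σ k}, Reg ⊥ f → f ≠ 0 := by
    rintro f hf rfl
    exact one_ne_zero (Ideal.mem_bot.1 (hf 1 (by simp)))
  -- For s = 0 the form f₁ is a unit and everything is empty; the coefficient degree s - 1 needs s >
  -- 0.
  rcases Nat.eq_zero_or_pos s with rfl | hs0
  · have hr0 := hs rfl
    subst hr0
    have htop : Ideal.span {f₁, f₂} = ⊤ := by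
      refine Ideal.eq_top_of_isUnit_mem _ (Ideal.subset_span (Set.mem_insert _ _)) ?_
      have h1 : f₁ ∈ homogeneousSubmodule σ k 0 := hf₁s
      rw [homogeneousSubmodule_zero] at h1
      obtain ⟨c, rfl⟩ := Submodule.mem_one.1 h1
      refine (IsUnit.mk0 c ?_).map (algebraMap k _)
      rintro rfl
      exact hne hf₁ (map_zero _)
    have hJt : J = ⊤ := by
      rw [Ideal.eq_top_iff_one, hJ]
      intro z _
      rw [htop]; trivial
    ext l
    rw [coeff_HS, hJt, hilb_top]
    simp
  obtain ⟨a, b, hab, ha, hb⟩ := exists_homogeneous_combination hh1 hgr hs0 hf₁s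
    (hle (Ideal.subset_span (Set.mem_insert _ _)))
  obtain ⟨c, e, hce, hc, he⟩ := exists_homogeneous_combination hh1 hgr (by omega) hf₂d
    (hle (Ideal.subset_span (Set.mem_insert_of_mem _ rfl)))
  have hdet := isHomogeneous_det hs0 hr ha hb hc he
  have hmul : ∀ {f : MvPolynomial σ k}, Reg ⊥ f → ∀ z, f * z = 0 → z = 0 := fun hf z hz =>
    Ideal.mem_bot.1 (hf z (Ideal.mem_bot.2 hz))
  have hJeq : J = Ideal.span {f₁, f₂} ⊔ Ideal.span {a * e - b * c} := by
    ext f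
    rw [hJ, mem_sup_span]
    constructor
    · intro hf
      exact exists_sub_mem_of_linked hab hce (hmul hh) hg (hmul hf₁) hf₂
        (hf h (Ideal.subset_span (Set.mem_insert _ _)))
        (hf g (Ideal.subset_span (Set.mem_insert_of_mem _ rfl)))
    · rintro ⟨w, hw⟩ z hz
      have h1 := Ideal.mul_mem_right z _ hw
      have h2 := Ideal.mul_mem_left _ w (mul_det_mem hab hce hz)
      have := Ideal.add_mem _ h1 h2
      convert this using 1
      ring
  have hquot : quot (Ideal.span {f₁, f₂}) (a * e - b * c) = Ideal.span {h, g} := by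
    ext f
    rw [mem_quot]
    exact ⟨mem_of_mul_det_mem hab hce (prime_of_linear (hne hh) hh1) (hne hf₁) hf₂,
      mul_det_mem hab hce⟩
  rw [hJeq, HS_sup_span (isGraded_span_pair hf₁s hf₂d) hdet, hquot,
    HS_span_pair hf₁s hf₂d hf₁ hf₂, HS_span_pair hh1 hgr hh hg, pow_one]
  ring

end GradedIdeal

namespace GradedIdeal

/-! ### Weakly regular sequences -/

theorem mem_smul_top_quotient_iff {R : Type*} [CommRing R] (I J : Ideal R) (z : R) :
    Ideal.Quotient.mk I z ∈ (J • ⊤ : Submodule R (R ⧸ I)) ↔ z ∈ I ⊔ J := by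
  have h1 : (J • ⊤ : Submodule R (R ⧸ I)) = Submodule.map I.mkQ J := by
    rw [← Submodule.range_mkQ I, LinearMap.range_eq_map, ← Submodule.map_smul'', smul_eq_mul,
      Ideal.mul_top]
  rw [h1]
  have h2 := Submodule.comap_map_mkQ I J
  rw [← h2]
  rfl

theorem isSMulRegular_quotient_smul_top_iff {R : Type*} [CommRing R] {I J : Ideal R} {f : R} :
    IsSMulRegular ((R ⧸ I) ⧸ (J • ⊤ : Submodule R (R ⧸ I))) f ↔ Reg (I ⊔ J) f := by
  rw [isSMulRegular_quotient_iff_mem_of_smul_mem]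
  constructor
  · intro h z hz
    rw [← mem_smul_top_quotient_iff]
    exact h _ ((mem_smul_top_quotient_iff I J (f * z)).2 hz)
  · intro h z
    obtain ⟨z, rfl⟩ := Ideal.Quotient.mk_surjective z
    intro hz
    rw [mem_smul_top_quotient_iff]
    exact h z ((mem_smul_top_quotient_iff I J (f * z)).1 hz)

theorem isWeaklyRegular_pair_iff {R : Type*} [CommRing R] {f g : R} :
    RingTheory.Sequence.IsWeaklyRegular R [f, g] ↔ Reg ⊥ f ∧ Reg (Ideal.span {f}) g := by
  rw [RingTheory.Sequence.isWeaklyRegular_iff]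
  have key : ∀ (J : Ideal R) (f : R), IsSMulRegular (R ⧸ (J • ⊤ : Submodule R R)) f ↔ Reg J f := by
    intro J f
    rw [isSMulRegular_quotient_iff_mem_of_smul_mem, smul_eq_mul, Ideal.mul_top]
    rfl
  simp only [key]
  constructor
  · intro h
    exact ⟨by simpa using h 0 (by simp), by simpa using h 1 (by simp)⟩
  · rintro ⟨h1, h2⟩ i hi
    have : i = 0 ∨ i = 1 := by
      simp only [List.length_cons, List.length_nil] at hi
      omega
    rcases this with rfl | rfl
    · simpa using h1
    · simpa using h2

variable {σ k : Type*} [Field k]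

theorem depthGE_of_reg_list : ∀ (fs : List (MvPolynomial σ k)) (I : Ideal (MvPolynomial σ k)),
    (∀ f ∈ fs, f ∈ idealOfVars σ k) →
    (∀ (i : ℕ) (hi : i < fs.length), Reg (I ⊔ Ideal.ofList (fs.take i)) fs[i]) →
    DepthGE fs.length I
  | [], _, _, _ => trivial
  | f :: fs, I, hm, hr => by
    refine ⟨f, hm f (by simp), ?_, ?_⟩
    · have := hr 0 (by simp)
      rwa [List.take_zero, Ideal.ofList_nil, sup_bot_eq] at this
    refine depthGE_of_reg_list fs _ (fun g hg => hm g (by simp [hg])) fun i hi => ?_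
    have := hr (i + 1) (by simpa using hi)
    simpa [sup_assoc] using this

theorem depthGE_of_isWeaklyRegular {I : Ideal (MvPolynomial σ k)} {fs : List (MvPolynomial σ k)}
    (hm : ∀ f ∈ fs, ∃ e : ℕ, 0 < e ∧ f.IsHomogeneous e)
    (h : RingTheory.Sequence.IsWeaklyRegular (MvPolynomial σ k ⧸ I) fs) :
    DepthGE fs.length I := by
  refine depthGE_of_reg_list fs I (fun f hf => ?_) fun i hi => ?_
  · obtain ⟨e, he, hfe⟩ := hm f hf
    exact mem_idealOfVars_of_homogeneous he hfe
  · rw [← isSMulRegular_quotient_smul_top_iff]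
    exact (RingTheory.Sequence.isWeaklyRegular_iff _ _).1 h i hi

/-! ### Degrees -/

/-- The series is p/(1 - X)^(q+1) with p the polynomial of coefficients h, so the degree q
coefficient of the Hilbert polynomial is p(1)/q!. -/
theorem exists_hilbertPolynomial {I : Ideal (MvPolynomial σ k)} {q N : ℕ} {h : ℕ → ℤ}
    (hh : ∀ l, h l = PowerSeries.coeff l ((1 - PowerSeries.X) ^ (q + 1) * HS I))
    (hN : ∀ l, N ≤ l → h l = 0) :
    ∃ P : Polynomial ℚ, (∃ l₀ : ℕ, ∀ l : ℕ, l₀ ≤ l → (hilb I l : ℚ) = P.eval (l : ℚ)) ∧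
      P.coeff q * (q.factorial : ℚ) = ((∑ l ∈ Finset.range N, h l : ℤ) : ℚ) := by
  set p : Polynomial ℚ := ∑ l ∈ Finset.range N, Polynomial.monomial l (h l : ℚ) with hp
  have hcoeff : ∀ l, p.coeff l = (h l : ℚ) := by
    intro l
    simp only [hp, Polynomial.finsetSum_coeff, Polynomial.coeff_monomial, Finset.sum_ite_eq',
      Finset.mem_range]
    split_ifs with hl
    · rfl
    · rw [hN l (by omega), Int.cast_zero]
  have hser : (p : PowerSeries ℚ) * (PowerSeries.invOneSubPow ℚ (q + 1)).val =
      PowerSeries.map (Int.castRingHom ℚ) (HS I) := by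
    have h1 : (p : PowerSeries ℚ) =
        PowerSeries.map (Int.castRingHom ℚ) ((1 - PowerSeries.X) ^ (q + 1) * HS I) := by
      ext l
      rw [Polynomial.coeff_coe, hcoeff, PowerSeries.coeff_map, hh l]
      rfl
    rw [h1, map_mul, map_pow, map_sub, map_one, PowerSeries.map_X,
      ← PowerSeries.invOneSubPow_inv_eq_one_sub_pow, mul_right_comm]
    simp
  refine ⟨p.hilbertPoly (q + 1), ⟨p.natDegree + 1, fun l hl => ?_⟩, ?_⟩
  · rw [← Polynomial.coeff_mul_invOneSubPow_eq_hilbertPoly_eval (q + 1) (by omega), hser,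
      PowerSeries.coeff_map, coeff_HS]
    simp
  · rw [Polynomial.hilbertPoly_succ, Polynomial.finsetSum_coeff, Finset.sum_mul, Int.cast_sum]
    have h1 : ∀ i, (p.coeff i • Polynomial.preHilbertPoly ℚ q i).coeff q * (q.factorial : ℚ) =
        (h i : ℚ) := by
      intro i
      rw [Polynomial.coeff_smul, Polynomial.coeff_preHilbertPoly_self, smul_eq_mul, mul_assoc,
        inv_mul_cancel₀ (by exact_mod_cast q.factorial_ne_zero), mul_one, hcoeff]
    simp only [h1]
    refine Finset.sum_subset (fun i hi => ?_) fun i _ hi => ?_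
    · rw [Polynomial.mem_support_iff, hcoeff] at hi
      by_contra hc
      rw [Finset.mem_range, not_lt] at hc
      exact hi (by rw [hN i hc, Int.cast_zero])
    · rwa [Polynomial.notMem_support_iff, hcoeff] at hi

theorem sum_eq_of_hilbertPolynomial {I : Ideal (MvPolynomial σ k)} {q N : ℕ} {h : ℕ → ℤ}
    (hh : ∀ l, h l = PowerSeries.coeff l ((1 - PowerSeries.X) ^ (q + 1) * HS I))
    (hN : ∀ l, N ≤ l → h l = 0) {P : Polynomial ℚ} {l₀ : ℕ}
    (hP : ∀ l : ℕ, l₀ ≤ l → (hilb I l : ℚ) = P.eval (l : ℚ)) :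
    P.coeff q * (q.factorial : ℚ) = ((∑ l ∈ Finset.range N, h l : ℤ) : ℚ) := by
  obtain ⟨Q, ⟨l₁, hQ⟩, hq⟩ := exists_hilbertPolynomial hh hN
  rw [← hq]
  congr 2
  refine Polynomial.eq_of_infinite_eval_eq P Q (Set.Infinite.mono (s := Set.range
    (fun l : ℕ => ((l + (l₀ + l₁) : ℕ) : ℚ))) ?_ (Set.infinite_range_of_injective fun a b hab => ?_))
  · rintro _ ⟨l, rfl⟩
    change Polynomial.eval _ P = Polynomial.eval _ Q
    rw [← hP _ (by omega), ← hQ _ (by omega)]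
  · have : a + (l₀ + l₁) = b + (l₀ + l₁) := by exact_mod_cast hab
    omega

/-! ### Artinian quotients -/

variable [Finite σ]

theorem exists_hilb_eq_zero_of_ringKrullDim_le_zero {I : Ideal (MvPolynomial σ k)}
    (hI : IsGraded I) (h : ringKrullDim (MvPolynomial σ k ⧸ I) ≤ 0) :
    ∃ N, ∀ l, N ≤ l → hilb I l = 0 := by
  have hfin : Module.Finite k (MvPolynomial σ k ⧸ I) :=
    (Module.finite_iff_krullDimLE_zero k _).2 (Ring.krullDimLE_iff.2 (by simpa using h))
  have hle : idealOfVars σ k ≤ I.radical := by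
    rw [idealOfVars, Ideal.span_le]
    rintro _ ⟨i, rfl⟩
    obtain ⟨p, hp, hpi⟩ := Algebra.IsIntegral.isIntegral (R := k) (Ideal.Quotient.mk I (X i))
    have h1 : Polynomial.aeval (X i) p ∈ I := by
      rw [← Ideal.Quotient.eq_zero_iff_mem, ← hpi, ← Polynomial.aeval_def]
      exact (Polynomial.aeval_algHom_apply (Ideal.Quotient.mkₐ k I) (X i) p).symm
    -- A monic relation for a variable holds in the quotient. As I is graded, it contains the top
    -- component, a pure power of that variable.
    have h2 := hI _ h1 p.natDegree
    have h3 : ∀ j, homogeneousComponent p.natDegree (p.coeff j • (X i : MvPolynomial σ k) ^ j) =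
        if p.natDegree = j then p.coeff j • X i ^ j else 0 := fun j =>
      homogeneousComponent_of_mem (Submodule.smul_mem _ _ (isHomogeneous_X_pow i j))
    rw [Polynomial.aeval_eq_sum_range, map_sum] at h2
    simp only [h3, Finset.sum_ite_eq, Finset.mem_range, Nat.lt_succ_self, if_true,
      hp.coeff_natDegree, one_smul] at h2
    exact ⟨_, h2⟩
  obtain ⟨N, hN⟩ := Ideal.exists_pow_le_of_le_radical_of_fg hle (idealOfVars_fg σ k)
  refine ⟨N, fun l hl => hilb_eq_zero_iff.2 fun f hf => hN ?_⟩
  rw [mem_pow_idealOfVars_iff]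
  intro x hx
  rw [Finsupp.degree_apply, ← hf.degree_eq_sum_deg_support hx]
  exact hl

end GradedIdeal

namespace GradedIdeal

/-! ### Coefficientwise comparison of power series -/

theorem coeff_eq_sum_of_one_sub_X_mul (A : PowerSeries ℤ) (l : ℕ) :
    PowerSeries.coeff l A =
      ∑ i ∈ Finset.range (l + 1), PowerSeries.coeff i ((1 - PowerSeries.X) * A) := by
  induction l with
  | zero => simp [sub_mul]
  | succ l ih =>
    rw [Finset.sum_range_succ, ← ih, sub_mul, one_mul, map_sub, PowerSeries.coeff_succ_X_mul]
    ring

theorem coeff_le_of_one_sub_X_pow_mul {A B : PowerSeries ℤ} (q : ℕ)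
    (h : ∀ l, PowerSeries.coeff l ((1 - PowerSeries.X) ^ q * A) ≤
      PowerSeries.coeff l ((1 - PowerSeries.X) ^ q * B)) :
    ∀ l, PowerSeries.coeff l A ≤ PowerSeries.coeff l B := by
  induction q with
  | zero => simpa using h
  | succ q ih =>
    refine ih fun l => ?_
    rw [coeff_eq_sum_of_one_sub_X_mul, coeff_eq_sum_of_one_sub_X_mul _ l]
    refine Finset.sum_le_sum fun i _ => ?_
    rw [← mul_assoc, ← pow_succ', ← mul_assoc, ← pow_succ']
    exact h i

theorem coeff_le_of_sum_le {A B : PowerSeries ℤ} (q : ℕ)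
    (h : ∀ L, ∑ i ∈ Finset.range L, PowerSeries.coeff i ((1 - PowerSeries.X) ^ (q + 1) * A) ≤
      ∑ i ∈ Finset.range L, PowerSeries.coeff i ((1 - PowerSeries.X) ^ (q + 1) * B)) :
    ∀ l, PowerSeries.coeff l A ≤ PowerSeries.coeff l B := by
  refine coeff_le_of_one_sub_X_pow_mul q fun l => ?_
  rw [coeff_eq_sum_of_one_sub_X_mul, coeff_eq_sum_of_one_sub_X_mul _ l,
    ← mul_assoc, ← pow_succ', ← mul_assoc, ← pow_succ']
  exact h (l + 1)

/-- The support is an interval ending at B - 1, and the sum is its length. It is used for the defect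
between a complete intersection and a subscheme of it. -/
theorem eq_indicator_of_upward_closed {δ : ℕ → ℤ} {B r M : ℕ} (h0 : ∀ l, 0 ≤ δ l)
    (h1 : ∀ l, δ l ≤ 1) (hB : ∀ l, B ≤ l → δ l = 0)
    (hup : ∀ l, 0 < δ l → l + 1 < B → 0 < δ (l + 1)) (hM : B ≤ M)
    (hsum : ∑ l ∈ Finset.range M, δ l = r) (l : ℕ) :
    δ l = if B - r ≤ l ∧ l < B then 1 else 0 := by
  classical
  obtain ⟨a, haB, ha⟩ : ∃ a ≤ B, ∀ l, δ l = if a ≤ l ∧ l < B then 1 else 0 := by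
    by_cases hex : ∃ a, 0 < δ a
    · have hlt : Nat.find hex < B := by
        by_contra hc
        have := Nat.find_spec hex
        rw [hB _ (by omega)] at this
        omega
      refine ⟨Nat.find hex, hlt.le, fun l => ?_⟩
      have hpos : ∀ l, Nat.find hex ≤ l → l < B → 0 < δ l := by
        intro l hl
        induction l, hl using Nat.le_induction with
        | base => exact fun _ => Nat.find_spec hex
        | succ l hl ih => exact fun h => hup l (ih (by omega)) h
      split_ifs with hl
      · have := hpos l hl.1 hl.2
        have := h1 l
        omega
      · rcases lt_or_ge l B with h | h
        · have := Nat.find_min hex (m := l) (by omega)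
          have := h0 l
          omega
        · exact hB l h
    · push Not at hex
      refine ⟨B, le_rfl, fun l => ?_⟩
      rw [if_neg (by omega)]
      have := h0 l
      have := hex l
      omega
  simp only [ha] at hsum
  rw [sum_Ico_indicator haB hM] at hsum
  rw [ha, show B - r = a by omega]

variable {σ k : Type*} [Field k]

/-! ### Saturation and homogeneous components -/

theorem NoSocle.saturated {I : Ideal (MvPolynomial σ k)} (h : NoSocle I) :
    ∀ (e : ℕ) (f : MvPolynomial σ k),
      (∀ g : MvPolynomial σ k, g.IsHomogeneous e → f * g ∈ I) → f ∈ I := by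
  intro e
  induction e with
  | zero => intro f hf; simpa using hf 1 (isHomogeneous_one σ k)
  | succ e ih =>
    intro f hf
    refine h f fun i => ih _ fun g hg => ?_
    have := hf (g * X i) (hg.mul (isHomogeneous_X k i))
    rwa [mul_comm (X i) f, mul_assoc, mul_comm (X i) g]

/-- A homogeneous element of `I ⊔ K` outside a graded `J ≥ K` comes from a homogeneous element
of `I`. -/
theorem exists_homogeneous_mem_of_mem_sup {I K J : Ideal (MvPolynomial σ k)} (hI : IsGraded I)
    (hK : IsGraded K) (hKJ : K ≤ J) {z : MvPolynomial σ k} {l : ℕ} (hz : z ∈ I ⊔ K)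
    (hzl : z.IsHomogeneous l) (hzJ : z ∉ J) : ∃ u ∈ I, u.IsHomogeneous l ∧ u ∉ J := by
  obtain ⟨i, hi, κ, hκ, rfl⟩ := Submodule.mem_sup.1 hz
  refine ⟨homogeneousComponent l i, hI _ hi l, homogeneousComponent_isHomogeneous l i, fun h => ?_⟩
  have h1 := homogeneousComponent_self hzl
  rw [map_add] at h1
  exact hzJ (h1 ▸ J.add_mem h (hKJ (hK _ hκ l)))

theorem ne_zero_of_reg_bot {f : MvPolynomial σ k} (hf : Reg ⊥ f) : f ≠ 0 := by
  rintro rfl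
  exact one_ne_zero (Ideal.mem_bot.1 (hf 1 (by simp)))

theorem one_notMem_of_prime {h : MvPolynomial σ k} (hh : Prime h) :
    (1 : MvPolynomial σ k) ∉ Ideal.span {h} := fun h1 =>
  hh.not_isUnit (isUnit_iff_dvd_one.2 (Ideal.mem_span_singleton.1 h1))

section

variable [Finite σ]

theorem hilb_eq_zero_of_le {I : Ideal (MvPolynomial σ k)} {e i : ℕ} (h : hilb I e = 0)
    (hi : e ≤ i) : hilb I i = 0 := by
  rw [hilb_eq_zero_iff] at *
  intro f hf
  have h1 : idealOfVars σ k ^ e ≤ I := by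
    rw [pow_idealOfVars_eq_span, Ideal.span_le]
    rintro _ ⟨x, hx, rfl⟩
    exact h _ (isHomogeneous_monomial 1 hx)
  refine h1 ((mem_pow_idealOfVars_iff e f).2 fun x hx => ?_)
  rw [Finsupp.degree_apply, ← hf.degree_eq_sum_deg_support hx]
  exact hi

theorem hilb_zero_pos {I : Ideal (MvPolynomial σ k)} (h : (1 : MvPolynomial σ k) ∉ I) :
    0 < hilb I 0 := by
  rw [Nat.pos_iff_ne_zero]
  exact fun h0 => h (hilb_eq_zero_iff.1 h0 1 (isHomogeneous_one σ k))

/-- The socle of a complete intersection in a plane, in terms of Hilbert functions. -/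
theorem IsPlane.hilb_lt_of_hilb_lt {K J : Ideal (MvPolynomial σ k)}
    {x y f g : MvPolynomial σ k} {a b l : ℕ} (hP : IsPlane K x y) (hfa : f.IsHomogeneous a)
    (hgb : g.IsHomogeneous b) (hf : Reg K f) (hg : Reg (K ⊔ Ideal.span {f}) g)
    (hle : K ⊔ Ideal.span {f} ⊔ Ideal.span {g} ≤ J)
    (hlt : hilb J l < hilb (K ⊔ Ideal.span {f} ⊔ Ideal.span {g}) l) (hl : l + 2 < a + b) :
    hilb J (l + 1) < hilb (K ⊔ Ideal.span {f} ⊔ Ideal.span {g}) (l + 1) := by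
  by_contra! hc
  have heq := gr_eq_of_hilb_eq (gr_mono hle (l + 1)) hc
  obtain ⟨u, huJ, hul, hu⟩ := exists_of_hilb_lt hlt
  -- If J agreed with the complete intersection in degree l + 1, every variable would send u into
  -- it, giving a socle element in a forbidden degree.
  refine hu (hP.mem_of_socle hfa hgb hf hg hul hl fun i => ?_)
  have h1 : X i * u ∈ gr J (l + 1) :=
    ⟨J.mul_mem_left _ huJ, by rw [add_comm]; exact (isHomogeneous_X k i).mul hul⟩
  rw [← heq] at h1
  exact h1.1

end

/-! ### The h-vector of an ideal linked to a degenerate one. -/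

variable [Fintype σ]

theorem IsPlane.reg_pair {m : ℕ} (hm : Fintype.card σ = m + 2) {K : Ideal (MvPolynomial σ k)}
    {x y f g : MvPolynomial σ k} {a b : ℕ} (hP : IsPlane K x y) (hfa : f.IsHomogeneous a)
    (hgb : g.IsHomogeneous b) (hf : Reg ⊥ f) (hg : Reg (Ideal.span {f}) g)
    (h1 : IsLinearSection m K (Ideal.span {f})) (h2 : IsLinearSection m K (Ideal.span {f, g})) :
    Reg K f ∧ Reg (K ⊔ Ideal.span {f}) g := by
  have hs1 : HS (K ⊔ Ideal.span {f}) = (1 - PowerSeries.X ^ a) * planeSeries := by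
    rw [sup_comm, h1.HS_span_singleton hm hfa hf]
  refine ⟨reg_of_HS hP.graded hfa (by rw [hs1, hP.HS_eq_planeSeries]),
    reg_of_HS (hP.graded.sup_span hfa) hgb ?_⟩
  rw [hs1, sup_assoc, ← span_pair_eq_sup, sup_comm, h2.HS_span_pair hm hfa hgb hf hg]
  ring

theorem IsLinearSection.hilb_span_pair_eq_linkedH {m : ℕ} (hm : Fintype.card σ = m + 2)
    {K : Ideal (MvPolynomial σ k)} {f g : MvPolynomial σ k} {a b : ℕ} (hfa : f.IsHomogeneous a)
    (hgb : g.IsHomogeneous b) (hf : Reg (⊥ : Ideal (MvPolynomial σ k)) f)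
    (hg : Reg (Ideal.span {f}) g) (h : IsLinearSection m K (Ideal.span {f, g})) (l : ℕ) :
    (hilb (K ⊔ Ideal.span {f} ⊔ Ideal.span {g}) l : ℤ) = linkedH a b 0 l := by
  rw [sup_assoc, ← span_pair_eq_sup, sup_comm, h.hilb_span_pair hm hfa hgb hf hg, linkedH,
    if_neg (by omega), sub_zero]

/-- An ACM ideal linked to a degenerate one by a complete intersection of type `(s, d)` has the
`h`-vector `linkedH`. -/
theorem hVector_eq_linkedH [Infinite k] {m s d r : ℕ} (hm : Fintype.card σ = m + 2)
    (hs : 0 < s) (hr : r < d) {I : Ideal (MvPolynomial σ k)} (hI : IsGraded I)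
    (hId : DepthGE m I) {f g t : MvPolynomial σ k} (hfs : f.IsHomogeneous s)
    (hgd : g.IsHomogeneous d) (hf : Reg ⊥ f) (hg : Reg (Ideal.span {f}) g)
    (hle : Ideal.span {f, g} ≤ I) (ht0 : t ≠ 0) (ht : t.IsHomogeneous 1)
    (htI : ∀ z ∈ I, t * z ∈ Ideal.span {f, g}) {h : ℕ → ℕ}
    (hh : ∀ l, (h l : ℤ) = PowerSeries.coeff l ((1 - PowerSeries.X) ^ m * HS I)) {N : ℕ}
    (hN : ∀ M, N ≤ M → ∑ i ∈ Finset.range M, (h i : ℤ) = s * d - r) (l : ℕ) :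
    (h l : ℤ) = linkedH s d r l := by
  have htr : Reg (⊥ : Ideal (MvPolynomial σ k)) t := reg_bot ht0
  obtain ⟨K, x, y, hP, hKS, hKT⟩ := exists_isPlane hm (S := {I, Ideal.span {f, g}})
    (T := {Ideal.span {f}, Ideal.span {t}}) (by simp) (by simp)
    (by
      rintro J (rfl | rfl)
      exacts [hI, isGraded_span_pair hfs hgd])
    (by
      rintro J (rfl | rfl)
      exacts [isGraded_span_singleton hfs, isGraded_span_singleton ht])
    (by
      rintro J (rfl | rfl)
      exacts [hId, depthGE_span_pair hm hf hg])
    (by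
      rintro J (rfl | rfl)
      exacts [depthGE_span_singleton hm hf, depthGE_span_singleton hm htr])
  have hIK : ∀ l, hilb (I ⊔ K) l = h l := fun l =>
    hilb_eq_of_HS (hKS I (by simp)).HS_eq (hh l).symm
  have hZ := (hKS (Ideal.span {f, g}) (by simp)).hilb_span_pair_eq_linkedH hm hfs hgd hf hg
  obtain ⟨hKf, hKg⟩ := hP.reg_pair hm hfs hgd hf hg (hKT _ (by simp)).1 (hKS _ (by simp))
  have htK := (hKT (Ideal.span {t}) (by simp)).1.hilb_span_singleton hm ht htr
  set W := K ⊔ Ideal.span {f} ⊔ Ideal.span {g} with hW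
  have hWeq : W = Ideal.span {f, g} ⊔ K := by
    rw [hW, sup_assoc, ← span_pair_eq_sup, sup_comm]
  have hWg : IsGraded W := (hP.graded.sup_span hfs).sup_span hgd
  have hWI : W ≤ I ⊔ K := by rw [hWeq]; exact sup_le_sup_right hle K
  have hIW : I ⊔ K ≤ quot W t := by
    refine sup_le (fun z hz => ?_) (le_trans (le_trans le_sup_left le_sup_left) (le_quot W t))
    rw [mem_quot, hWeq]
    exact Ideal.mem_sup_left (htI z hz)
  have hWt : W ⊔ Ideal.span {t} = Ideal.span {t} ⊔ K ⊔ Ideal.span {f, g} := by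
    rw [hWeq, sup_comm, sup_assoc, sup_comm K]
  -- Modulo K and t one variable remains, numerically, so every value is 1 before f and g are
  -- imposed.
  have ht1 : ∀ i, hilb (W ⊔ Ideal.span {t}) i ≤ 1 := fun i => by
    have h1 := hilb_anti (show Ideal.span {t} ⊔ K ≤ W ⊔ Ideal.span {t} by
      rw [hWt]; exact le_sup_left) i
    have := htK i
    omega
  have ht2 : ∀ i, s ≤ i → d ≤ i → hilb (W ⊔ Ideal.span {t}) i = 0 := by
    have key : ∀ (p : MvPolynomial σ k) (e : ℕ), p.IsHomogeneous e → p ∈ Ideal.span {f, g} →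
        p ∉ Ideal.span {t} ⊔ K → ∀ i, e ≤ i → hilb (W ⊔ Ideal.span {t}) i = 0 := by
      intro p e hpe hpm hp i hi
      refine hilb_eq_zero_of_le ?_ hi
      by_contra hne
      have h1 : gr (Ideal.span {t} ⊔ K) e = gr (W ⊔ Ideal.span {t}) e := by
        refine gr_eq_of_hilb_eq (gr_mono (by rw [hWt]; exact le_sup_left) e) ?_
        have := htK e
        omega
      have h2 : p ∈ gr (W ⊔ Ideal.span {t}) e :=
        ⟨by rw [hWt]; exact Ideal.mem_sup_right hpm, hpe⟩
      rw [← h1] at h2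
      exact hp h2.1
    intro i hsi hdi
    by_cases hfm : f ∈ Ideal.span {t} ⊔ K
    · by_cases hgm : g ∈ Ideal.span {t} ⊔ K
      -- If f and g both vanished modulo K + (t), W would have positive Hilbert function in degree s
      -- + d, where it is 0.
      · exfalso
        have h1 : W ≤ Ideal.span {t} ⊔ K := sup_le (sup_le le_sup_right
          ((Ideal.span_singleton_le_iff_mem _).2 hfm)) ((Ideal.span_singleton_le_iff_mem _).2 hgm)
        have h2 := hilb_anti h1 (s + d)
        have h3 := hZ (s + d)
        have h4 := htK (s + d)
        unfold linkedH at h3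
        split_ifs at h3 <;> omega
      · exact key g d hgd (Ideal.subset_span (by simp)) hgm i hdi
    · exact key f s hfs (Ideal.subset_span (by simp)) hfm i hsi
  have hδ := eq_indicator_of_upward_closed (δ := fun l => (hilb W l : ℤ) - h l)
    (B := s + d - 1) (r := r) (M := N + (s + d)) ?_ ?_ ?_ ?_ (by omega) ?_ l
  · simp only [hZ] at hδ
    unfold linkedH at *
    rw [← hδ]
    split_ifs <;> omega
  · intro l
    have := hilb_anti hWI l
    rw [hIK] at this
    omega
  -- As I + K ⊆ (W : t), the defect at l is at most h_W(l) - h_W(l+1) plus the value of A/(W + (t))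
  -- at l + 1. Below max(s, d) the first difference is nonpositive and the second term at most 1;
  -- from there on they are at most 1 and 0.
  · intro l
    have h1 := hilb_sup_span_add hWg ht l
    have h2 := hilb_anti hIW l
    rw [hIK] at h2
    have h3 := ht1 (l + 1)
    have h4 := ht2 (l + 1)
    have h5 := hZ l
    have h6 := hZ (l + 1)
    unfold linkedH at h5 h6
    split_ifs at h5 h6 <;> omega
  · intro l hl
    have h1 := hilb_anti hWI l
    rw [hIK] at h1
    have h5 := hZ l
    unfold linkedH at h5
    split_ifs at h5 <;> omega
  · intro l hl hlB
    have h1 := hP.hilb_lt_of_hilb_lt (J := I ⊔ K) (l := l) hfs hgd hKf hKg hWI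
      (by rw [hIK, ← hW]; omega) (by omega)
    rw [hIK, ← hW] at h1
    omega
  · rw [Finset.sum_sub_distrib, hN _ (by omega)]
    simp only [hZ]
    rw [sum_linkedH (by omega) (by omega)]
    push_cast
    ring

end GradedIdeal

/-! ### Reconstructing the linkage from the h-vector. -/

namespace GradedIdeal

variable {σ k : Type*} [Field k]

/-- An ideal generated by a complete intersection and one form `u`, where `(I_W : u)` is a complete
intersection of type `(1, r)`, is the residual of the latter. -/
theorem mem_of_linked {s d r : ℕ} (hs : 0 < s) (hr : r < d) {f g t q u : MvPolynomial σ k}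
    (hfs : f.IsHomogeneous s) (hgd : g.IsHomogeneous d) (hf : Reg ⊥ f)
    (hg : Reg (Ideal.span {f}) g) (ht1 : t.IsHomogeneous 1) (hqr : q.IsHomogeneous r)
    (ht : Reg ⊥ t) (hq : Reg (Ideal.span {t}) q) (hu : u.IsHomogeneous (s + d - 1 - r))
    (hquot : quot (Ideal.span {f, g}) u = Ideal.span {t, q}) (huW : u ∉ Ideal.span {f, g})
    (z : MvPolynomial σ k) : z ∈ Ideal.span {f, g} ⊔ Ideal.span {u} ↔
      ∀ w ∈ Ideal.span {t, q}, z * w ∈ Ideal.span {f, g} := by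
  have hle : Ideal.span {f, g} ≤ Ideal.span {t, q} := hquot ▸ le_quot _ _
  have hWg : IsGraded (Ideal.span {f, g}) := isGraded_span_pair hfs hgd
  obtain ⟨a, b, hab, ha, hb⟩ := exists_homogeneous_combination ht1 hqr hs hfs
    (hle (Ideal.subset_span (Set.mem_insert _ _)))
  obtain ⟨c, e, hce, hc, he⟩ := exists_homogeneous_combination ht1 hqr (by omega) hgd
    (hle (Ideal.subset_span (Set.mem_insert_of_mem _ rfl)))
  have hdet := isHomogeneous_det hs hr ha hb hc he
  have hmul : ∀ {f : MvPolynomial σ k}, Reg ⊥ f → ∀ z, f * z = 0 → z = 0 := fun hf z hz =>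
    Ideal.mem_bot.1 (hf z (Ideal.mem_bot.2 hz))
  have hlink : ∀ v : MvPolynomial σ k, (∀ w ∈ Ideal.span {t, q}, v * w ∈ Ideal.span {f, g}) →
      v ∈ Ideal.span {f, g} ⊔ Ideal.span {a * e - b * c} := fun v hv => by
    rw [mem_sup_span]
    exact exists_sub_mem_of_linked hab hce (hmul ht) hq (hmul hf) hg
      (hv t (Ideal.subset_span (Set.mem_insert _ _)))
      (hv q (Ideal.subset_span (Set.mem_insert_of_mem _ rfl)))
  have hres : ∀ w ∈ Ideal.span {t, q}, u * w ∈ Ideal.span {f, g} := fun w hw => by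
    rw [← hquot] at hw; exact hw
  constructor
  · intro hz w hw
    obtain ⟨v, hv⟩ := mem_sup_span.1 hz
    have := Ideal.add_mem _ (Ideal.mul_mem_right w _ hv) (Ideal.mul_mem_left _ v (hres w hw))
    convert this using 1
    ring
  · intro hz
    have hle2 : Ideal.span {a * e - b * c} ≤ Ideal.span {f, g} ⊔ Ideal.span {u} := by
      rw [Ideal.span_singleton_le_iff_mem]
      -- The form u lies in the residual and has the degree of the determinant, so modulo (f, g) the
      -- two differ by a nonzero scalar.
      obtain ⟨v, hv0, hv⟩ := (hWg.mem_sup_span_iff (l := 0) hdet (by rwa [zero_add])).1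
        (hlink u hres)
      have hv1 : v ∈ homogeneousSubmodule σ k 0 := hv0
      rw [homogeneousSubmodule_zero] at hv1
      obtain ⟨x, rfl⟩ := Submodule.mem_one.1 hv1
      have hx : x ≠ 0 := by
        rintro rfl
        exact huW (by simpa using hv)
      refine mem_sup_span.2 ⟨algebraMap k _ x⁻¹, ?_⟩
      have h1 : algebraMap k (MvPolynomial σ k) x⁻¹ * algebraMap k _ x = 1 := by
        rw [← map_mul, inv_mul_cancel₀ hx, map_one]
      have := Ideal.mul_mem_left _ (-algebraMap k (MvPolynomial σ k) x⁻¹) hv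
      convert this using 1
      linear_combination -(a * e - b * c) * h1
    exact sup_le le_sup_left hle2 (hlink z hz)

theorem HS_linear_pair (r : ℕ) : (1 - PowerSeries.X ^ 1) * (1 - PowerSeries.X ^ r) *
    HS (⊥ : Ideal (MvPolynomial σ k)) =
      (1 - PowerSeries.X) * HS (⊥ : Ideal (MvPolynomial σ k)) - PowerSeries.X ^ r *
        ((1 - PowerSeries.X) * HS (⊥ : Ideal (MvPolynomial σ k))) := by ring

variable [Fintype σ]

/-- A graded ideal with the Hilbert series of a complete intersection of type `(1, r)` is one. -/
theorem exists_linear_pair {r : ℕ} (hr : 0 < r) {N : Ideal (MvPolynomial σ k)} (hN : IsGraded N)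
    (hHS : HS N = (1 - PowerSeries.X ^ 1) * (1 - PowerSeries.X ^ r) *
      HS (⊥ : Ideal (MvPolynomial σ k))) :
    ∃ t g : MvPolynomial σ k, t.IsHomogeneous 1 ∧ g.IsHomogeneous r ∧ Reg ⊥ t ∧
      Reg (Ideal.span {t}) g ∧ N = Ideal.span {t, g} := by
  have hone : (1 : MvPolynomial σ k) ∉ (⊥ : Ideal (MvPolynomial σ k)) := by simp
  have hlt : hilb N 1 < hilb (⊥ : Ideal (MvPolynomial σ k)) 1 := by
    have h1 := hilb_zero_pos hone
    have h2 := coeff_HS N 1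
    have : (1 - PowerSeries.X ^ 1) * (1 - PowerSeries.X ^ r) *
        HS (⊥ : Ideal (MvPolynomial σ k)) = HS (⊥ : Ideal (MvPolynomial σ k)) -
        PowerSeries.X ^ 1 * HS (⊥ : Ideal (MvPolynomial σ k)) - PowerSeries.X ^ r *
        HS (⊥ : Ideal (MvPolynomial σ k)) + PowerSeries.X ^ (r + 1) *
        HS (⊥ : Ideal (MvPolynomial σ k)) := by ring
    rw [hHS, this] at h2
    simp only [map_add, map_sub, PowerSeries.coeff_X_pow_mul', coeff_HS] at h2
    rw [if_pos le_rfl, if_neg (show ¬ r + 1 ≤ 1 by omega)] at h2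
    simp only [Nat.sub_self] at h2
    split_ifs at h2 <;> omega
  obtain ⟨t, htN, ht1, ht0⟩ := exists_of_hilb_lt hlt
  have ht : t ≠ 0 := fun h => ht0 (by simp [h])
  have htr : Reg (⊥ : Ideal (MvPolynomial σ k)) t := reg_bot ht
  have hprime := prime_of_linear ht ht1
  have htS := HS_span_singleton ht1 htr
  have hlt2 : hilb N r < hilb (Ideal.span {t}) r := by
    have h1 := hilb_zero_pos (one_notMem_of_prime hprime)
    have h2 := coeff_HS N r
    rw [hHS, HS_linear_pair, map_sub, PowerSeries.coeff_X_pow_mul', if_pos le_rfl, Nat.sub_self,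
      ← pow_one (PowerSeries.X : PowerSeries ℤ), ← htS, coeff_HS, coeff_HS] at h2
    omega
  obtain ⟨g, hgN, hgr, hgt⟩ := exists_of_hilb_lt hlt2
  have hg : Reg (Ideal.span {t}) g :=
    reg_span_of_prime hprime fun h => hgt (Ideal.mem_span_singleton.2 h)
  refine ⟨t, g, ht1, hgr, htr, hg, (eq_of_HS_eq hN ?_ ?_).symm⟩
  · rw [Ideal.span_le]
    rintro _ (rfl | rfl)
    exacts [htN, hgN]
  · rw [hHS, HS_span_pair ht1 hgr htr hg]

/-- An ACM ideal whose Hilbert series is that of the standard linked ideal contains a form of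
degree `s` not divisible by `F`. -/
theorem exists_form_not_dvd [Infinite k] {m s d r : ℕ} (hm : Fintype.card σ = m + 2)
    (hr : r < d) {I : Ideal (MvPolynomial σ k)} (hI : IsGraded I)
    (hId : DepthGE m I) {F : MvPolynomial σ k} (hF : F ≠ 0) (hFd : F.IsHomogeneous d)
    (hh : ∀ l, PowerSeries.coeff l ((1 - PowerSeries.X) ^ m * HS I) = linkedH s d r l) :
    ∃ f ∈ I, f.IsHomogeneous s ∧ ¬ F ∣ f := by
  have hF0 : Reg (⊥ : Ideal (MvPolynomial σ k)) F := reg_bot hF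
  obtain ⟨K, hK, hKS⟩ := exists_isLinearSection m (S := {I, Ideal.span {F}}) (by simp)
    (by
      rintro J (rfl | rfl)
      exacts [hI, isGraded_span_singleton hFd])
    (by
      rintro J (rfl | rfl)
      exacts [hId, (depthGE_span_singleton hm hF0).of_succ])
  have h1 := coeff_HS (I ⊔ K) s
  rw [(hKS I (by simp)).HS_eq, hh] at h1
  have h2 := (hKS (Ideal.span {F}) (by simp)).hilb_span_singleton hm hFd hF0 s
  -- In degree s the section of F has value min(s + 1, d), while `linkedH` is strictly smaller.
  obtain ⟨z, hz, hzs, hzF⟩ := exists_of_hilb_lt (I := Ideal.span {F} ⊔ K) (J := I ⊔ K) (l := s)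
    (by unfold linkedH at h1; split_ifs at h1 <;> omega)
  obtain ⟨f, hfI, hfs, hfF⟩ := exists_homogeneous_mem_of_mem_sup hI hK le_sup_right hz hzs hzF
  exact ⟨f, hfI, hfs, fun h => hfF (Ideal.mem_sup_left (Ideal.mem_span_singleton.2 h))⟩

/-- An ACM ideal containing a complete intersection of type `(s, d)` and whose `h`-vector is
`linkedH` is generated by the complete intersection and one more form. -/
theorem exists_generator [Infinite k] {m s d r : ℕ} (hm : Fintype.card σ = m + 2)
    (hs : 0 < s) (hr : r < d) (hr0 : 0 < r) {I : Ideal (MvPolynomial σ k)} (hI : IsGraded I)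
    (hId : DepthGE m I) {f g : MvPolynomial σ k} (hfs : f.IsHomogeneous s)
    (hgd : g.IsHomogeneous d) (hf : Reg ⊥ f) (hg : Reg (Ideal.span {f}) g)
    (hle : Ideal.span {f, g} ≤ I)
    (hh : ∀ l, PowerSeries.coeff l ((1 - PowerSeries.X) ^ m * HS I) = linkedH s d r l) :
    ∃ u : MvPolynomial σ k, u.IsHomogeneous (s + d - 1 - r) ∧ u ∉ Ideal.span {f, g} ∧
      I = Ideal.span {f, g} ⊔ Ideal.span {u} := by
  obtain ⟨K, x, y, hP, hKS, hKT⟩ := exists_isPlane hm (S := {I, Ideal.span {f, g}})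
    (T := {Ideal.span {f}}) (by simp) (by simp)
    (by
      rintro J (rfl | rfl)
      exacts [hI, isGraded_span_pair hfs hgd])
    (by simpa using isGraded_span_singleton hfs)
    (by
      rintro J (rfl | rfl)
      exacts [hId, depthGE_span_pair hm hf hg])
    (by simpa using depthGE_span_singleton hm hf)
  have hIK : ∀ l, (hilb (I ⊔ K) l : ℤ) = linkedH s d r l := fun l => by
    rw [← coeff_HS, (hKS I (by simp)).HS_eq, hh]
  have hZ := (hKS (Ideal.span {f, g}) (by simp)).hilb_span_pair_eq_linkedH hm hfs hgd hf hg
  obtain ⟨hKf, hKg⟩ := hP.reg_pair hm hfs hgd hf hg (hKT _ (by simp)).1 (hKS _ (by simp))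
  set W := K ⊔ Ideal.span {f} ⊔ Ideal.span {g} with hW
  have hWeq : W = Ideal.span {f, g} ⊔ K := by
    rw [hW, sup_assoc, ← span_pair_eq_sup, sup_comm]
  have hWI : W ≤ I ⊔ K := by rw [hWeq]; exact sup_le_sup_right hle K
  set c := s + d - 1 - r with hc
  obtain ⟨z, hz, hzc, hzW⟩ := exists_of_hilb_lt (I := W) (J := I ⊔ K) (l := c) (by
    have h1 := hIK c
    have h2 := hZ c
    unfold linkedH at h1 h2
    split_ifs at h1 h2 <;> omega)
  obtain ⟨u, huI, huc, huW⟩ := exists_homogeneous_mem_of_mem_sup hI hP.graded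
    (hWeq ▸ le_sup_right) hz hzc hzW
  have hWu : W ⊔ Ideal.span {u} ≤ I ⊔ K :=
    sup_le hWI ((Ideal.span_singleton_le_iff_mem _).2 (Ideal.mem_sup_left huI))
  -- The single form u already accounts for the whole defect: the socle property carries the drop in
  -- degree c through every degree up to s + d - 2.
  have hstep : ∀ l, c ≤ l → l < s + d - 1 → hilb (W ⊔ Ideal.span {u}) l < hilb W l := by
    intro l hl
    induction l, hl using Nat.le_induction with
    | base =>
      intro _
      by_contra! hge
      have h1 := gr_eq_of_hilb_eq (gr_mono (le_sup_left : W ≤ W ⊔ Ideal.span {u}) c) hge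
      have h2 : u ∈ gr (W ⊔ Ideal.span {u}) c :=
        ⟨Ideal.mem_sup_right (Ideal.mem_span_singleton_self u), huc⟩
      rw [← h1] at h2
      exact huW h2.1
    | succ l hl ih =>
      intro hlt
      exact hP.hilb_lt_of_hilb_lt hfs hgd hKf hKg le_sup_left (ih (by omega)) (by omega)
  refine ⟨u, huc, fun h => huW (hWeq ▸ Ideal.mem_sup_left h),
    ((hKS I (by simp)).nakayama _ (sup_le hle ((Ideal.span_singleton_le_iff_mem _).2 huI))
      ((isGraded_span_pair hfs hgd).sup_span huc) ?_).symm⟩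
  rw [sup_right_comm, ← hWeq]
  refine eq_of_hilb_eq (hI.sup hP.graded) hWu fun l => ?_
  have h1 := hIK l
  have h2 := hZ l
  have h3 := hstep l
  have h4 := hilb_anti (le_sup_left : W ≤ W ⊔ Ideal.span {u}) l
  unfold linkedH at h1 h2
  split_ifs at h1 h2 <;> omega

end GradedIdeal

/-! ### Translation to subschemes of projective space. -/

namespace ProjSubscheme

open GradedIdeal

variable {k : Type*} [Field k]

theorem isGraded {n : ℕ} (X : ProjSubscheme k n) : IsGraded X.ideal := X.homogeneous

theorem hilbertFunction_eq {n : ℕ} (X : ProjSubscheme k n) (l : ℕ) :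
    X.hilbertFunction l = hilb X.ideal l := rfl

/-- The subscheme defined by a graded ideal of positive depth. -/
def ofNoSocle {n : ℕ} (I : Ideal (HomogCoordRing k n)) (hI : IsGraded I) (h : NoSocle I) :
    ProjSubscheme k n where
  ideal := I
  homogeneous := hI
  saturated f := fun ⟨e, he⟩ => h.saturated e f he

theorem isCompleteIntersection_iff {n : ℕ} {X : ProjSubscheme k n} {a b : ℕ} :
    X.IsCompleteIntersection a b ↔ ∃ f g : HomogCoordRing k n, f.IsHomogeneous a ∧
      g.IsHomogeneous b ∧ Reg ⊥ f ∧ Reg (Ideal.span {f}) g ∧ X.ideal = Ideal.span {f, g} := by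
  simp only [IsCompleteIntersection, isWeaklyRegular_pair_iff, and_assoc]

variable {q : ℕ}

theorem le_of_add_natCast_le {x : WithBot ℕ∞} {a b : ℕ}
    (h : x + (a : ℕ) ≤ ((b + a : ℕ) : WithBot ℕ∞)) : x ≤ (b : ℕ) := by
  induction x with
  | bot => exact bot_le
  | coe x =>
    have h1 : x + a ≤ ((b + a : ℕ) : ℕ∞) := by exact_mod_cast h
    have h2 : x ≤ (b : ℕ∞) := by
      rw [Nat.cast_add] at h1
      exact (ENat.add_le_add_iff_right (ENat.natCast_ne_top a)).1 h1
    exact_mod_cast h2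

theorem card_fin_eq : Fintype.card (Fin (q + 2 + 1)) = (q + 1) + 2 := by simp

theorem IsACM.depthGE {Y : ProjSubscheme k (q + 2)} (hY : Y.IsACM) (hdim : Y.HasDim q) :
    DepthGE (q + 1) Y.ideal := by
  rcases hdim with htop | hdim
  · rw [htop]; exact depthGE_top _
  obtain ⟨m, hm, fs, hlen, hfs, hreg⟩ := hY
  rcases hm with htop | hm
  · rw [htop]; exact depthGE_top _
  have hmq : m + 1 = q + 1 := by
    rw [hdim] at hm
    exact_mod_cast hm.symm
  rw [← hmq, ← hlen]
  exact depthGE_of_isWeaklyRegular hfs hreg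

/-- The `h`-vector of an ACM subscheme of codimension two. -/
theorem IsACM.exists_hVector [Infinite k] {Y : ProjSubscheme k (q + 2)} (hY : Y.IsACM)
    (hdim : Y.HasDim q) {α : ℕ} (hα : Y.HasDegree α) :
    ∃ h : ℕ → ℕ, (∀ l, (h l : ℤ) =
      PowerSeries.coeff l ((1 - PowerSeries.X) ^ (q + 1) * HS Y.ideal)) ∧
      ∃ N, ∀ M, N ≤ M → ∑ i ∈ Finset.range M, (h i : ℤ) = α := by
  have hd := hY.depthGE hdim
  obtain ⟨m, hm, P, ⟨l₀, hP⟩, hPα⟩ := hα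
  -- The empty subscheme has every dimension, so its degree may be witnessed in any m; in all of
  -- them it is 0.
  by_cases htop : Y.ideal = ⊤
  · have hHS : HS Y.ideal = 0 := by
      ext l
      rw [coeff_HS, htop, hilb_top]
      simp
    refine ⟨fun _ => 0, fun l => by simp [hHS], 0, fun M _ => ?_⟩
    have := sum_eq_of_hilbertPolynomial (q := m) (N := 0) (h := fun _ => 0) (I := Y.ideal)
      (by simp [hHS]) (by simp) hP
    rw [hPα] at this
    simp only [Finset.range_zero, Finset.sum_empty, Int.cast_zero, Nat.cast_eq_zero] at this
    simp [this]
  have hdim' := hdim.resolve_left htop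
  have hmq : m = q := by
    have h1 := hm.resolve_left htop
    rw [hdim'] at h1
    have : q + 1 = m + 1 := by exact_mod_cast h1
    omega
  subst hmq
  obtain ⟨K, hK, hKS⟩ := exists_isLinearSection (m + 1) (S := {Y.ideal}) (by simp)
    (by simpa using Y.isGraded) (by simpa using hd)
  have hYK := hKS _ rfl
  have hzero : ringKrullDim (HomogCoordRing k (m + 2) ⧸ Y.ideal ⊔ K) ≤ 0 := by
    have h1 := hYK.dim_le
    rw [hdim'] at h1
    exact le_of_add_natCast_le (a := m + 1) (b := 0) (by rw [zero_add]; exact h1)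
  obtain ⟨N, hN⟩ := exists_hilb_eq_zero_of_ringKrullDim_le_zero (Y.isGraded.sup hK) hzero
  have hcoeff : ∀ l, (hilb (Y.ideal ⊔ K) l : ℤ) =
      PowerSeries.coeff l ((1 - PowerSeries.X) ^ (m + 1) * HS Y.ideal) := fun l => by
    rw [← hYK.HS_eq, coeff_HS]
  refine ⟨fun l => hilb (Y.ideal ⊔ K) l, hcoeff, N, fun M hM => ?_⟩
  have := sum_eq_of_hilbertPolynomial (N := M) hcoeff
    (fun l hl => by rw [hN l (by omega), Nat.cast_zero]) hP
  rw [hPα] at this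
  exact_mod_cast this.symm

theorem coeff_HS_of_linked {s d r : ℕ} (hs : s = 0 → r = 0) (hr : r < d)
    {C Z Δ : ProjSubscheme k (q + 2)} (hC : C.IsCompleteIntersection 1 r)
    (hZ : Z.IsCompleteIntersection s d) (hΔ : Δ.IsResidual C Z) (l : ℕ) :
    PowerSeries.coeff l ((1 - PowerSeries.X) ^ (q + 1) * HS Δ.ideal) = linkedH s d r l := by
  obtain ⟨t, g, ht, hg, htr, hgr, hCI⟩ := isCompleteIntersection_iff.1 hC
  obtain ⟨f₁, f₂, hf₁, hf₂, hf₁r, hf₂r, hZI⟩ := isCompleteIntersection_iff.1 hZ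
  rw [HS_of_linked hs hr ht hg htr hgr hf₁ hf₂ hf₁r hf₂r (hCI ▸ hZI ▸ hΔ.1)
    (fun f => by rw [← hCI, ← hZI]; exact hΔ.2 f), mul_left_comm,
    one_sub_X_pow_mul_HS_bot card_fin_eq, coeff_linkedH hr]

/-- Two nonzerodivisors bound the dimension above. The lower bound comes from a nonzero section by q
+ 1 linear forms, nonzero because r > 0. -/
theorem ringKrullDim_linear_pair [Infinite k] {r : ℕ} (hr : 0 < r)
    {t g : HomogCoordRing k (q + 2)} (ht1 : t.IsHomogeneous 1) (hgr : g.IsHomogeneous r)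
    (ht : Reg ⊥ t) (hg : Reg (Ideal.span {t}) g) :
    ringKrullDim (HomogCoordRing k (q + 2) ⧸ Ideal.span {t, g}) = ((q + 1 : ℕ) : WithBot ℕ∞) := by
  have hdepth := depthGE_span_pair card_fin_eq ht hg
  obtain ⟨K, hK, hKS⟩ := exists_isLinearSection (q + 1) (S := {Ideal.span {t, g}}) (by simp)
    (by simpa using isGraded_span_pair ht1 hgr) (by simpa using hdepth)
  have hsec := hKS _ rfl
  have hne : Ideal.span {t, g} ⊔ K ≠ ⊤ := by
    intro htop
    have h1 := hsec.hilb_span_pair card_fin_eq ht1 hgr ht hg 0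
    rw [htop, hilb_top] at h1
    omega
  have hlower : ((q + 1 : ℕ) : WithBot ℕ∞) ≤
      ringKrullDim (HomogCoordRing k (q + 2) ⧸ Ideal.span {t, g}) := by
    refine le_trans ?_ hsec.dim_le
    have : Nontrivial (HomogCoordRing k (q + 2) ⧸ Ideal.span {t, g} ⊔ K) :=
      Ideal.Quotient.nontrivial_iff.2 hne
    exact le_add_of_nonneg_left ringKrullDim_nonneg_of_nontrivial
  refine le_antisymm ?_ hlower
  have h1 := ringKrullDim_sup_span_add_one_le ht
  have h2 := ringKrullDim_sup_span_add_one_le hg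
  rw [bot_sup_eq] at h1
  rw [← span_pair_eq_sup] at h2
  have h3 : ringKrullDim (HomogCoordRing k (q + 2) ⧸ (⊥ : Ideal (HomogCoordRing k (q + 2)))) =
      ((q + 3 : ℕ) : WithBot ℕ∞) := by
    rw [ringKrullDim_eq_of_ringEquiv (RingEquiv.quotientBot _),
      MvPolynomial.ringKrullDim_of_isNoetherianRing, ringKrullDim_eq_zero_of_field]
    simp only [Nat.card_eq_fintype_card, Fintype.card_fin, zero_add]
  rw [h3] at h1
  refine le_of_add_natCast_le (a := 2) ?_
  refine le_trans (le_of_eq ?_) ((add_le_add_left h2 1).trans h1)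
  generalize ringKrullDim (HomogCoordRing k (q + 2) ⧸ Ideal.span {t, g}) = x
  rw [add_assoc, one_add_one_eq_two, Nat.cast_ofNat]

theorem hasDegree_linear_pair [Infinite k] {r : ℕ} (hr : 0 < r)
    {t g : HomogCoordRing k (q + 2)} (ht1 : t.IsHomogeneous 1) (hgr : g.IsHomogeneous r)
    (ht : Reg ⊥ t) (hg : Reg (Ideal.span {t}) g) {D : ProjSubscheme k (q + 2)}
    (hD : D.ideal = Ideal.span {t, g}) : D.HasDim q ∧ D.HasDegree r := by
  have hdim : D.HasDim q := Or.inr (by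
    change ringKrullDim (HomogCoordRing k (q + 2) ⧸ D.ideal) = _
    rw [hD]; exact ringKrullDim_linear_pair hr ht1 hgr ht hg)
  refine ⟨hdim, q, hdim, ?_⟩
  have hh : ∀ l, (if 0 ≤ l ∧ l < r then (1 : ℤ) else 0) =
      PowerSeries.coeff l ((1 - PowerSeries.X) ^ (q + 1) * HS D.ideal) := by
    intro l
    rw [hD, HS_span_pair ht1 hgr ht hg, mul_left_comm, one_sub_X_pow_mul_HS_bot card_fin_eq]
    have : (1 - PowerSeries.X ^ 1) * (1 - PowerSeries.X ^ r) * planeSeries =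
      planeSeries - PowerSeries.X ^ 1 * planeSeries - PowerSeries.X ^ r * planeSeries +
        PowerSeries.X ^ (r + 1) * planeSeries := by ring
    rw [this]
    simp only [map_add, map_sub, coeff_planeSeries, coeff_X_pow_mul_planeSeries]
    split_ifs <;> omega
  obtain ⟨P, hP, hPq⟩ := exists_hilbertPolynomial (N := r) hh
    (fun l hl => if_neg (by omega))
  refine ⟨P, hP, ?_⟩
  rw [hPq, sum_Ico_indicator (Nat.zero_le r) le_rfl]
  simp

/-- The empty subscheme. -/
noncomputable def empty (n : ℕ) : ProjSubscheme k n where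
  ideal := ⊤
  homogeneous := isGraded_top
  saturated _ _ := trivial

theorem hasDim_empty {n m : ℕ} : (empty n : ProjSubscheme k n).HasDim m := Or.inl rfl

theorem hasDegree_empty {n : ℕ} : (empty n : ProjSubscheme k n).HasDegree 0 := by
  refine ⟨0, hasDim_empty, 0, ⟨0, fun l _ => ?_⟩, by simp⟩
  rw [hilbertFunction_eq]
  simp [empty, hilb_top]

theorem isDegenerate_empty {n : ℕ} : (empty n : ProjSubscheme k n).IsDegenerate :=
  ⟨X 0, X_ne_zero 0, isHomogeneous_X k 0, trivial⟩

theorem isResidual_empty {n : ℕ} {Y W : ProjSubscheme k n} (h : Y.ideal = W.ideal) :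
    Y.IsResidual (empty n) W := by
  refine ⟨le_top, fun f => ?_⟩
  rw [h]
  exact ⟨fun hf g _ => Ideal.mul_mem_right g _ hf, fun hf => by simpa using hf 1 trivial⟩

theorem hVector_eq_of_isResidual [Infinite k] {s d r : ℕ} (hs : s = 0 → r = 0) (hr : r < d)
    {Y W D : ProjSubscheme k (q + 2)} (hY : DepthGE (q + 1) Y.ideal)
    (hW : W.IsCompleteIntersection s d) (hD : D.IsDegenerate) (hYDW : Y.IsResidual D W)
    {h : ℕ → ℕ}
    (hh : ∀ l, (h l : ℤ) = PowerSeries.coeff l ((1 - PowerSeries.X) ^ (q + 1) * HS Y.ideal))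
    {N : ℕ} (hN : ∀ M, N ≤ M → ∑ i ∈ Finset.range M, (h i : ℤ) = s * d - r) (l : ℕ) :
    (h l : ℤ) = linkedH s d r l := by
  obtain ⟨f, g, hfs, hgd, hf, hg, hWI⟩ := isCompleteIntersection_iff.1 hW
  obtain ⟨t, ht0, ht1, htD⟩ := hD
  rcases Nat.eq_zero_or_pos s with rfl | hs0
  · have h1 := hN (N + l + 1) (by omega)
    have h2 : (h l : ℤ) ≤ ∑ i ∈ Finset.range (N + l + 1), (h i : ℤ) :=
      Finset.single_le_sum (f := fun i => (h i : ℤ)) (fun i _ => Int.natCast_nonneg _)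
        (Finset.mem_range.2 (by omega))
    rw [h1, hs rfl] at h2
    have h3 := hs rfl
    unfold linkedH
    split_ifs <;> omega
  · refine hVector_eq_linkedH card_fin_eq hs0 hr Y.isGraded hY hfs hgd hf hg ?_ ht0 ht1 ?_ hh hN l
    · rw [← hWI]
      exact fun z hz => (hYDW.2 z).2 fun w _ => Ideal.mul_mem_right w _ hz
    · intro z hz
      rw [← hWI, mul_comm]
      exact (hYDW.2 z).1 hz t htD

theorem exists_isResidual [Infinite k] {s d r : ℕ} (hs : s = 0 → r = 0) (hr : r < d)
    {Y : ProjSubscheme k (q + 2)} (hY : DepthGE (q + 1) Y.ideal) {F : HomogCoordRing k (q + 2)}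
    (hF : Irreducible F) (hFd : F.IsHomogeneous d) (hFY : F ∈ Y.ideal)
    (hh : ∀ l, PowerSeries.coeff l ((1 - PowerSeries.X) ^ (q + 1) * HS Y.ideal) =
      linkedH s d r l) :
    ∃ W D : ProjSubscheme k (q + 2), W.IsCompleteIntersection s d ∧
      D.HasCodim 2 ∧ D.HasDegree r ∧ D.IsDegenerate ∧ Y.IsResidual D W := by
  have hF0 : Reg (⊥ : Ideal (HomogCoordRing k (q + 2))) F := reg_bot hF.ne_zero
  obtain ⟨f, hfY, hfs, hFf⟩ := exists_form_not_dvd card_fin_eq hr Y.isGraded hY hF.ne_zero hFd hh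
  have hf : Reg (⊥ : Ideal (HomogCoordRing k (q + 2))) f :=
    reg_bot fun h => hFf (h ▸ dvd_zero F)
  have hfF : Reg (Ideal.span {f}) F := by
    have := Reg.swap (I := ⊥) hF0 (g := f)
      (by rw [bot_sup_eq]; exact reg_span_of_prime hF.prime hFf)
    rwa [bot_sup_eq] at this
  have hle : Ideal.span {f, F} ≤ Y.ideal := by
    rw [Ideal.span_le]
    rintro _ (rfl | rfl)
    exacts [hfY, hFY]
  set W : ProjSubscheme k (q + 2) := ofNoSocle (Ideal.span {f, F}) (isGraded_span_pair hfs hFd)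
    (depthGE_span_pair card_fin_eq hf hfF).noSocle with hW
  have hWI : W.ideal = Ideal.span {f, F} := rfl
  have hWCI : W.IsCompleteIntersection s d :=
    isCompleteIntersection_iff.2 ⟨f, F, hfs, hFd, hf, hfF, rfl⟩
  have hHS : HS Y.ideal = ((1 - PowerSeries.X ^ s) * (1 - PowerSeries.X ^ d) -
      PowerSeries.X ^ (s + d - 1 - r) * (1 - PowerSeries.X) * (1 - PowerSeries.X ^ r)) *
        HS (⊥ : Ideal (HomogCoordRing k (q + 2))) := by
    refine mul_left_cancel₀ (pow_ne_zero (q + 1) one_sub_X_ne_zero) ?_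
    rw [mul_left_comm, one_sub_X_pow_mul_HS_bot card_fin_eq]
    ext l
    rw [hh, coeff_linkedH hr]
  have hHSW := HS_span_pair hfs hFd hf hfF
  -- For r = 0 the series of Y and W agree, so Y = W is residual to the empty subscheme.
  rcases Nat.eq_zero_or_pos r with rfl | hr0
  · have hYW : Y.ideal = W.ideal := (eq_of_HS_eq Y.isGraded hle (by
      rw [hHS, hHSW, pow_zero, sub_self, mul_zero, sub_zero])).symm
    exact ⟨W, empty _, hWCI, ⟨q, rfl, hasDim_empty⟩, hasDegree_empty, isDegenerate_empty,
      isResidual_empty hYW⟩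
  have hs0 : 0 < s := Nat.pos_of_ne_zero fun h => by rw [hs h] at hr0; exact lt_irrefl _ hr0
  obtain ⟨u, hu, huW, hYu⟩ := exists_generator card_fin_eq hs0 hr hr0 Y.isGraded hY hfs hFd hf hfF
    hle hh
  have hNHS : HS (quot (Ideal.span {f, F}) u) = (1 - PowerSeries.X ^ 1) *
      (1 - PowerSeries.X ^ r) * HS (⊥ : Ideal (HomogCoordRing k (q + 2))) := by
    -- The exact sequence for u isolates the series of (W : u) as that of a complete intersection
    -- (1, r).
    have h1 := HS_sup_span W.isGraded hu
    rw [hWI, ← hYu, hHS, hHSW] at h1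
    refine mul_left_cancel₀ (pow_ne_zero (s + d - 1 - r) PowerSeries.X_ne_zero) ?_
    linear_combination h1
  obtain ⟨t, g, ht1, hgr, ht, hg, hN⟩ := exists_linear_pair hr0 (W.isGraded.quot hu) hNHS
  set D : ProjSubscheme k (q + 2) := ofNoSocle (Ideal.span {t, g}) (isGraded_span_pair ht1 hgr)
    (depthGE_span_pair card_fin_eq ht hg).noSocle with hD
  have hDI : D.ideal = Ideal.span {t, g} := rfl
  obtain ⟨hDdim, hDdeg⟩ := hasDegree_linear_pair hr0 ht1 hgr ht hg hDI
  refine ⟨W, D, hWCI, ⟨q, rfl, hDdim⟩, hDdeg,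
    ⟨t, ne_zero_of_reg_bot ht, ht1, Ideal.subset_span (Set.mem_insert _ _)⟩, ?_, fun z => ?_⟩
  · rw [hDI, ← hN]
    exact le_quot _ _
  · rw [hYu]
    exact mem_of_linked hs0 hr hfs hFd hf hfF ht1 hgr ht hg hu hN huW z

end ProjSubscheme

theorem mainTheorem8 {k : Type*} [Field k] [IsAlgClosed k] [CharZero k] {n : ℕ}
    (s d r α : ℕ) (hr : r < d) (hα : (α : ℤ) = (s : ℤ) * (d : ℤ) - (r : ℤ))
    -- `Δ` is the residual of a complete intersection `(1, r)` in a complete intersection `(s, d)`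
    (C Z Δ : ProjSubscheme k n)
    (hC : C.IsCompleteIntersection 1 r) (hZ : Z.IsCompleteIntersection s d)
    (hΔ : Δ.IsResidual C Z)
    -- `Y` is ACM of codimension two and degree `α`
    (Y : ProjSubscheme k n) (hYacm : Y.IsACM) (hYcodim : Y.HasCodim 2) (hYdeg : Y.HasDegree α)
    -- `Y` lies in the irreducible hypersurface `F = 0` of degree `d`
    (F : HomogCoordRing k n) (hFirr : Irreducible F) (hFdeg : F.IsHomogeneous d)
    (hYF : F ∈ Y.ideal) :
    (∀ l : ℕ, Δ.hilbertFunction l ≤ Y.hilbertFunction l) ∧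
    ((∀ l : ℕ, Y.hilbertFunction l = Δ.hilbertFunction l) ↔
      ∃ W D : ProjSubscheme k n, W.IsCompleteIntersection s d ∧
        D.HasCodim 2 ∧ D.HasDegree r ∧ D.IsDegenerate ∧ Y.IsResidual D W) := by
  open GradedIdeal in
  have : Infinite k := IsAlgClosed.instInfinite
  obtain ⟨q, rfl, hdim⟩ := hYcodim
  have hs : s = 0 → r = 0 := by
    rintro rfl
    rw [Nat.cast_zero, zero_mul] at hα
    omega
  have hdepth := hYacm.depthGE hdim
  obtain ⟨h, hh, N, hN⟩ := hYacm.exists_hVector hdim hYdeg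
  rw [hα] at hN
  have hΔh := ProjSubscheme.coeff_HS_of_linked hs hr hC hZ hΔ
  have hadm : IsAdmissible d h :=
    isAdmissible_of_depthGE ProjSubscheme.card_fin_eq Y.isGraded hdepth hFirr hFdeg hYF hh
  refine ⟨fun l => ?_, fun heq => ?_, ?_⟩
  -- Of the q + 1 summations leading from h to the Hilbert function, one is spent on the partial
  -- sums; the other q preserve the inequality.
  · have := coeff_le_of_sum_le (A := HS Δ.ideal) (B := HS Y.ideal) q (fun L => by
      simp only [hΔh, ← hh]
      exact hadm.sum_linkedH_le hr hN L) l
    rw [coeff_HS, coeff_HS] at this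
    exact_mod_cast this
  · have hHS : HS Y.ideal = HS Δ.ideal := by
      ext l
      rw [coeff_HS, coeff_HS]
      exact_mod_cast heq l
    exact ProjSubscheme.exists_isResidual hs hr hdepth hFirr hFdeg hYF
      fun l => by rw [hHS, hΔh]
  · rintro ⟨W, D, hW, -, -, hD, hYDW⟩ l
    have hlink := ProjSubscheme.hVector_eq_of_isResidual hs hr hdepth hW hD hYDW hh hN
    have hHS : HS Y.ideal = HS Δ.ideal := by
      refine mul_left_cancel₀ (pow_ne_zero (q + 1) one_sub_X_ne_zero) ?_
      ext l
      rw [← hh, hlink, hΔh]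
    exact hilb_eq_of_HS_eq hHS l
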